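/- Consider the surface of the unit cube $[0,1]^3$. A \emph{geodesic} on it is a curve that is locally straight and has surface angle exactly $\pi$ to each side at every interior point (so it passes through no vertex). A \emph{geodesic segment} is a non-self-intersecting geodesic that starts and ends at vertices of the cube. A \emph{simple closed quasigeodesic} is a simple closed curve on the surface that is locally straight on either side of each of its points and has surface angle at most $\pi$ to each side at every point; it is thus composed of geodesic segments as soon as it passes through a vertex. The \emph{slope} of a geodesic segment is $\tan\alpha\in[0,1]$, where $\alpha\in[0,\pi/4]$ is the angle that its initial direction makes, in its starting face, with one of the two edges of that face at the starting vertex. \textbf{Lemma.} Every geodesic segment that is a component of a simple closed quasigeodesic on the cube has slope $0$, $1/3$, $1/2$, $2/3$ or $1$ in its starting face. -/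

import Mathlib

noncomputable section

namespace CubeQuasigeodesic

open Filter Topology

/-- Euclidean 3-space. -/
abbrev Space : Type := EuclideanSpace ℝ (Fin 3)

/-- The six faces of the unit cube `[0,1]³`: the face `x i = 0` or `x i = 1`. -/
def face (i : Fin 3) (b : Bool) : Set Space :=
  {x | (∀ j, x j ∈ Set.Icc (0 : ℝ) 1) ∧ x i = if b then 1 else 0}

/-- The surface of the cube. -/
def surface : Set Space := {x | ∃ i b, x ∈ face i b}

/-- The eight vertices of the cube. -/
def IsVertex (x : Space) : Prop := ∀ j, x j = 0 ∨ x j = 1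

/-- `u` is a unit direction that points from the point `x` of a (convex) face into that face. -/
def IsFaceDir (i : Fin 3) (b : Bool) (x u : Space) : Prop :=
  x ∈ face i b ∧ ‖u‖ = 1 ∧ ∃ ε : ℝ, 0 < ε ∧ x + ε • u ∈ face i b

/-- `SectorChain x u w r`: on the surface one can turn about `x` from the direction `u` to the
direction `w` through finitely many planar sectors, each inside one face, of total angle `r`. -/
inductive SectorChain (x : Space) : Space → Space → ℝ → Prop
  | sector {i : Fin 3} {b : Bool} {u w : Space} (hu : IsFaceDir i b x u)
      (hw : IsFaceDir i b x w) : SectorChain x u w (InnerProductGeometry.angle u w)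
  | cons {i : Fin 3} {b : Bool} {u v w : Space} {r : ℝ} (hu : IsFaceDir i b x u)
      (hv : IsFaceDir i b x v) (h : SectorChain x v w r) :
      SectorChain x u w (InnerProductGeometry.angle u v + r)

open Classical in
/-- The total surface angle at a point of the cube surface: three right angles at a vertex,
`2π` at every other point. -/
def totalAngle (x : Space) : ℝ := if IsVertex x then 3 * Real.pi / 2 else 2 * Real.pi

/-- The directions of the surface at `x` form a circle of length `totalAngle x`, which two
directions `u`, `w` divide into two arcs, one for each side of a curve that arrives along `u` and
leaves along `w`. This is the surface angle on the side where it is smaller. -/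
def smallerSide (x u w : Space) : ℝ := sInf {r | SectorChain x u w r}

/-- The surface angle on the other side. -/
def largerSide (x u w : Space) : ℝ := totalAngle x - smallerSide x u w

/-- Just after time `t` the curve runs straight with unit speed in the direction `w`. -/
def Departs (γ : ℝ → Space) (t : ℝ) (w : Space) : Prop :=
  ‖w‖ = 1 ∧ ∀ᶠ s in 𝓝[≥] (0 : ℝ), γ (t + s) = γ t + s • w

/-- Just before time `t` the curve runs straight with unit speed; `u` is the direction that points
from `γ t` back along the curve. -/
def Arrives (γ : ℝ → Space) (t : ℝ) (u : Space) : Prop :=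
  ‖u‖ = 1 ∧ ∀ᶠ s in 𝓝[≥] (0 : ℝ), γ (t - s) = γ t + s • u

/-- At time `t` the curve has exactly `π` surface to each side. -/
def IsGeodesicAt (γ : ℝ → Space) (t : ℝ) : Prop :=
  ∃ u w, Arrives γ t u ∧ Departs γ t w ∧
    smallerSide (γ t) u w = Real.pi ∧ largerSide (γ t) u w = Real.pi

/-- At time `t` the curve has at most `π` surface to each side. -/
def IsQuasigeodesicAt (γ : ℝ → Space) (t : ℝ) : Prop :=
  ∃ u w, Arrives γ t u ∧ Departs γ t w ∧
    smallerSide (γ t) u w ≤ Real.pi ∧ largerSide (γ t) u w ≤ Real.pi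

/-- A simple closed quasigeodesic on the cube of length `L`, parametrized by arc length. -/
structure IsSimpleClosedQuasigeodesic (L : ℝ) (γ : ℝ → Space) : Prop where
  length_pos : 0 < L
  closed : Function.Periodic γ L
  simple : Set.InjOn γ (Set.Ico 0 L)
  mem_surface : ∀ t, γ t ∈ surface
  quasigeodesic : ∀ t, IsQuasigeodesicAt γ t

/-- On the parameter interval `[a, b]` the curve `γ` is a geodesic segment: a
non-self-intersecting vertex-to-vertex geodesic. (Its endpoints may be the same vertex; that no
vertex is passed in between follows from the condition at interior points.) -/
structure IsGeodesicSegment (γ : ℝ → Space) (a b : ℝ) : Prop where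
  lt : a < b
  continuousOn : ContinuousOn γ (Set.Icc a b)
  mem_surface : ∀ t ∈ Set.Icc a b, γ t ∈ surface
  start_vertex : IsVertex (γ a)
  end_vertex : IsVertex (γ b)
  geodesic : ∀ t ∈ Set.Ioo a b, IsGeodesicAt γ t
  simple : Set.InjOn γ (Set.Ico a b)

/-- The curve starts at time `a` from the vertex `γ a` with slope `σ ∈ [0,1]` in its starting
face: there are a face at `γ a`, with perpendicular unit edge vectors `e`, `e'` from `γ a` along
the two edges of that face, such that the curve departs in the direction of `e + σ e'`. -/
def HasStartingSlope (γ : ℝ → Space) (a σ : ℝ) : Prop :=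
  0 ≤ σ ∧ σ ≤ 1 ∧ ∃ i b e e' w, γ a ∈ face i b ∧ e ≠ e' ∧
    ‖e‖ = 1 ∧ IsVertex (γ a + e) ∧ γ a + e ∈ face i b ∧
    ‖e'‖ = 1 ∧ IsVertex (γ a + e') ∧ γ a + e' ∈ face i b ∧
    Departs γ a w ∧ ∃ c : ℝ, 0 < c ∧ w = c • (e + σ • e')

end CubeQuasigeodesic

end

noncomputable section

namespace CubeQuasigeodesic

open Filter Topology

/-! Unfold the cube onto the lattice plane along the segment, with its starting vertex at the
origin. If its slope lies strictly between two consecutive listed values, there is a strip `0 < D₂ x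
- D₁ y < 1`, free of lattice points inside, that unfolds a cylinder on the cube closing up under
translation by `m D`. The four strips have `D = (0,1), (2,1), (1,2), (1,1)`, the first and third
with the axes exchanged. In each, the direction of `D` and that of the far-side vertex `v` are
exactly the two bounding slopes. The segment therefore reaches the far side only beyond `v`, at an
angle of tangent below `1/3` to the strip, and by then the exit vertex `V k` is at least one full
turn of the cylinder away from the start.

This is incompatible with simplicity. A cube vertex carries the angle `3π/2`, of which `π` lies in
the cylinder, so only `π/2` is left outside. A curve leaving flatly between `V (k - 1)` and `V k` is
thus rotated by a quarter turn about `V k`, re-enters the strip and crosses the translate by `m D`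
of its own earlier pass (`Crosses.false_of_glue`, `Crosses.false_of_left`). If it hits `V k`
instead, the quasigeodesic condition lets it turn left by at most a right angle: it re-enters the
strip and crosses itself (`Crosses.false_of_band`), or leaves flatly as before, or follows the side.
In the last case the same alternatives arise at each further vertex, until the curve returns to `V
k` from a second direction (`Crosses.false_of_vertex`). `Cylinder.not_follows` combines these cases.

Two foundations carry the argument. The angle conditions force straight continuation inside faces
and across edges (`departs_face`, `departs_edge`) and restrict the turn at vertices
(`departs_vertex`); `eqOn_of_forced` propagates this along lines of the plane. Simplicity means that
two passes through one point differ by a period, hence have the same directions (`eq_add_of_eq`). -/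

/-- A vertex of the cube (given by its bits) together with an ordering of the three axes. -/
abbrev Frame : Type := (Fin 3 → Bool) × Equiv.Perm (Fin 3)

/-! ### Coordinates of the cube in a frame, and rolling of frames. -/

namespace Frame

/-- The point with coordinates `v` in the frame `F`. -/
def pt (F : Frame) (v : Fin 3 → ℝ) : Space :=
  WithLp.toLp 2 fun n => if F.1 n then 1 - v (F.2.symm n) else v (F.2.symm n)

/-- The vector with coordinates `v` in the frame `F`. -/
def vec (F : Frame) (v : Fin 3 → ℝ) : Space :=
  WithLp.toLp 2 fun n => if F.1 n then -v (F.2.symm n) else v (F.2.symm n)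

/-- Move a frame along its axis `k` and exchange this axis with axis `l`. -/
def move (k l : Fin 3) (F : Frame) : Frame :=
  (Function.update F.1 (F.2 k) (!F.1 (F.2 k)), F.2 * Equiv.swap k l)

theorem move_move (k l : Fin 3) (F : Frame) : move l k (move k l F) = F := by
  revert k l F; decide

/-- Roll the frame over the edge `x = 1` of its face. -/
def right : Equiv.Perm Frame := ⟨move 0 2, move 2 0, move_move 0 2, move_move 2 0⟩

/-- Roll the frame over the edge `y = 1` of its face. -/
def up : Equiv.Perm Frame := ⟨move 1 2, move 2 1, move_move 1 2, move_move 2 1⟩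

/-- The frame at the next corner of the same face. -/
def turn (F : Frame) : Frame := move 1 0 F

/-- Each of these words rolls a frame along one period `D` of a strip. Its exponent is the number
`m` of periods after which the unfolding repeats; as there are only 48 frames, this is a finite
check. -/
theorem urr_pow : (up * right * right) ^ 2 = 1 := Equiv.ext (by decide)
theorem ur_pow : (up * right) ^ 3 = 1 := Equiv.ext (by decide)
theorem uru_pow : (up * right * up) ^ 2 = 1 := Equiv.ext (by decide)

theorem pt_add_smul_vec (F : Frame) (v w : Fin 3 → ℝ) (s : ℝ) :
    F.pt v + s • F.vec w = F.pt fun n => v n + s * w n := by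
  ext n
  simp only [pt, vec, PiLp.add_apply, PiLp.smul_apply, smul_eq_mul]
  split_ifs <;> ring

theorem inner_vec (F : Frame) (v w : Fin 3 → ℝ) :
    inner ℝ (F.vec v) (F.vec w) = ∑ n, v n * w n := by
  rw [PiLp.inner_apply, ← Equiv.sum_comp F.2]
  refine Finset.sum_congr rfl fun n _ => ?_
  simp only [vec, Equiv.symm_apply_apply, RCLike.inner_apply, conj_trivial]
  split_ifs <;> ring

theorem norm_vec (F : Frame) (v : Fin 3 → ℝ) : ‖F.vec v‖ = Real.sqrt (∑ n, v n * v n) := by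
  rw [← F.inner_vec, real_inner_self_eq_norm_sq, Real.sqrt_sq (norm_nonneg _)]

theorem norm_vec_eq_one {F : Frame} {v : Fin 3 → ℝ} (h : ∑ n, v n * v n = 1) :
    ‖F.vec v‖ = 1 := by
  rw [norm_vec, h, Real.sqrt_one]

theorem sum_of_norm {F : Frame} {v : Fin 3 → ℝ} (h : ‖F.vec v‖ = 1) : ∑ n, v n * v n = 1 := by
  rw [← F.inner_vec, real_inner_self_eq_norm_sq, h, one_pow]

theorem angle_vec (F : Frame) {v w : Fin 3 → ℝ} (hv : ∑ n, v n * v n = 1)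
    (hw : ∑ n, w n * w n = 1) :
    InnerProductGeometry.angle (F.vec v) (F.vec w) = Real.arccos (∑ n, v n * w n) := by
  rw [InnerProductGeometry.angle, norm_vec_eq_one hv, norm_vec_eq_one hw, inner_vec]
  simp

theorem exists_vec (F : Frame) (w : Space) : ∃ v, F.vec v = w := by
  refine ⟨fun n => if F.1 (F.2 n) then -w (F.2 n) else w (F.2 n), ?_⟩
  ext n
  simp only [vec, Equiv.apply_symm_apply]
  split_ifs <;> ring

theorem vec_injective (F : Frame) : Function.Injective F.vec := by
  intro v w h
  ext n
  have := congrArg (fun x : Space => x (F.2 n)) h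
  simp only [vec, Equiv.symm_apply_apply] at this
  split_ifs at this <;> linarith

theorem pt_mem_face (F : Frame) (m : Fin 3) (v : Fin 3 → ℝ) :
    F.pt v ∈ face (F.2 m) (F.1 (F.2 m)) ↔ (∀ n, v n ∈ Set.Icc (0 : ℝ) 1) ∧ v m = 0 := by
  simp only [face, Set.mem_ofPred_eq, pt, Equiv.symm_apply_apply]
  refine and_congr ⟨fun h n => ?_, fun h n => ?_⟩ ?_
  · have := h (F.2 n)
    simp only [Equiv.symm_apply_apply, Set.mem_Icc] at this ⊢
    split_ifs at this
    · constructor <;> linarith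
    · exact this
  · have := h (F.2.symm n)
    simp only [Set.mem_Icc] at this ⊢
    split_ifs
    · constructor <;> linarith
    · exact this
  · split_ifs <;> constructor <;> intro h <;> linarith

theorem isVertex_pt (F : Frame) (v : Fin 3 → ℝ) :
    IsVertex (F.pt v) ↔ ∀ n, v n = 0 ∨ v n = 1 := by
  simp only [IsVertex, pt]
  refine ⟨fun h n => ?_, fun h n => ?_⟩
  · have := h (F.2 n)
    simp only [Equiv.symm_apply_apply] at this
    split_ifs at this
    · rcases this with h | h
      · exact Or.inr (by linarith)
      · exact Or.inl (by linarith)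
    · exact this
  · have := h (F.2.symm n)
    split_ifs
    · rcases this with h | h
      · exact Or.inr (by linarith)
      · exact Or.inl (by linarith)
    · exact this

/-- Only the active constraints need a sign condition on the direction; the others survive a short
step by continuity. -/
theorem isFaceDir (F : Frame) {m : Fin 3} {v w : Fin 3 → ℝ} (hv : v m = 0) (hw : w m = 0)
    (hw1 : ∑ n, w n * w n = 1) (hv01 : ∀ n, v n ∈ Set.Icc (0 : ℝ) 1)
    (h0 : ∀ n, v n = 0 → 0 ≤ w n) (h1 : ∀ n, v n = 1 → w n ≤ 0) :
    IsFaceDir (F.2 m) (F.1 (F.2 m)) (F.pt v) (F.vec w) := by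
  refine ⟨(F.pt_mem_face m v).2 ⟨hv01, hv⟩, norm_vec_eq_one hw1, ?_⟩
  have key : ∀ n, ∀ᶠ s in 𝓝[>] (0 : ℝ), v n + s * w n ∈ Set.Icc (0 : ℝ) 1 := by
    intro n
    have hc : Tendsto (fun s : ℝ => v n + s * w n) (𝓝[>] 0) (𝓝 (v n)) := by
      have : Continuous fun s : ℝ => v n + s * w n := by fun_prop
      simpa using (this.tendsto 0).mono_left nhdsWithin_le_nhds
    have lo : ∀ᶠ s in 𝓝[>] (0 : ℝ), 0 ≤ v n + s * w n := by
      rcases (hv01 n).1.eq_or_lt with h | h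
      · filter_upwards [self_mem_nhdsWithin] with s hs
        have hs : 0 < s := hs
        have := mul_nonneg hs.le (h0 n h.symm)
        linarith
      · filter_upwards [hc.eventually (lt_mem_nhds h)] with s hs using hs.le
    have hi : ∀ᶠ s in 𝓝[>] (0 : ℝ), v n + s * w n ≤ 1 := by
      rcases (hv01 n).2.eq_or_lt with h | h
      · filter_upwards [self_mem_nhdsWithin] with s hs
        have hs : 0 < s := hs
        have := mul_nonneg hs.le (neg_nonneg.2 (h1 n h))
        linarith
      · filter_upwards [hc.eventually (gt_mem_nhds h)] with s hs using hs.le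
    filter_upwards [lo, hi] with s h h' using ⟨h, h'⟩
  obtain ⟨s, hs, hs0⟩ := ((eventually_all.2 key).and self_mem_nhdsWithin).exists
  refine ⟨s, hs0, ?_⟩
  rw [pt_add_smul_vec, pt_mem_face]
  exact ⟨hs, by simp [hv, hw]⟩

end Frame

/-! ### How the angle conditions determine the departing direction. -/

section local_rules

theorem SectorChain.nonneg {x u w : Space} {r : ℝ} (h : SectorChain x u w r) : 0 ≤ r := by
  induction h with
  | sector => exact InnerProductGeometry.angle_nonneg _ _
  | cons _ _ _ ih => exact add_nonneg (InnerProductGeometry.angle_nonneg _ _) ih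

/-- This is the only fact about the infimum that is needed: the bound on the larger side bounds the
smaller side from below, so every explicit chain of sectors yields an inequality. -/
theorem smallerSide_le {x u w : Space} {r : ℝ} (h : SectorChain x u w r) :
    smallerSide x u w ≤ r :=
  csInf_le ⟨0, fun _ hr => SectorChain.nonneg hr⟩ h

theorem Departs.unique {γ : ℝ → Space} {t : ℝ} {w w' : Space} (h : Departs γ t w)
    (h' : Departs γ t w') : w = w' := by
  have := (h.2.and h'.2).filter_mono (nhdsWithin_mono 0 Set.Ioi_subset_Ici_self)
  obtain ⟨s, ⟨h1, h2⟩, hs⟩ := (this.and self_mem_nhdsWithin).exists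
  have hs : 0 < s := hs
  rw [h1] at h2
  exact smul_right_injective _ hs.ne' (add_left_cancel h2)

theorem Arrives.unique {γ : ℝ → Space} {t : ℝ} {w w' : Space} (h : Arrives γ t w)
    (h' : Arrives γ t w') : w = w' := by
  have := (h.2.and h'.2).filter_mono (nhdsWithin_mono 0 Set.Ioi_subset_Ici_self)
  obtain ⟨s, ⟨h1, h2⟩, hs⟩ := (this.and self_mem_nhdsWithin).exists
  have hs : 0 < s := hs
  rw [h1] at h2
  exact smul_right_injective _ hs.ne' (add_left_cancel h2)

/-- A direction in which a segment on the surface starts is a direction of some face. -/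
theorem exists_dir_of_segment (F : Frame) {v : Fin 3 → ℝ} {w : Space} (hw : ‖w‖ = 1)
    (h : ∀ᶠ s in 𝓝[≥] (0 : ℝ), F.pt v + s • w ∈ surface) :
    ∃ w', w = F.vec w' ∧ ∑ n, w' n * w' n = 1 ∧ (∃ m, (v m = 0 ∨ v m = 1) ∧ w' m = 0) ∧
      (∀ n, v n = 0 → 0 ≤ w' n) := by
  obtain ⟨w', rfl⟩ := F.exists_vec w
  refine ⟨w', rfl, Frame.sum_of_norm hw, ?_⟩
  obtain ⟨ε, hε, hS⟩ := (mem_nhdsGE_iff_exists_Ico_subset).1 h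
  have hε : 0 < ε := hε
  have hin : ∀ s, 0 ≤ s → s < ε → (∀ n, v n + s * w' n ∈ Set.Icc (0 : ℝ) 1) ∧
      ∃ m, v m + s * w' m = 0 ∨ v m + s * w' m = 1 := by
    intro s h0 h1
    obtain ⟨i, b, hx⟩ := hS ⟨h0, h1⟩
    rw [Frame.pt_add_smul_vec] at hx
    obtain ⟨hx, hx'⟩ := hx
    constructor
    · intro n
      have := hx (F.2 n)
      simp only [Frame.pt, Equiv.symm_apply_apply, Set.mem_Icc] at this ⊢
      split_ifs at this
      · constructor <;> linarith
      · exact this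
    · refine ⟨F.2.symm i, ?_⟩
      simp only [Frame.pt] at hx'
      split_ifs at hx' <;> first | (left; linarith) | (right; linarith)
  constructor
  · choose! m hm using fun s h0 h1 => (hin s h0 h1).2
    have hpos : ∀ k : ℕ, 0 ≤ ε / (k + 2) ∧ ε / (k + 2) < ε := fun k =>
      ⟨by positivity, by rw [div_lt_iff₀ (by positivity)]; nlinarith [Nat.cast_nonneg (α := ℝ) k]⟩
    -- Pigeonhole: two of the times `ε / (k + 2)` put the point on the same face plane, recorded by
    -- its axis and by whether the coordinate is `0`, so the direction has no component along that
    -- axis. The offset `2` keeps all times below `ε`.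
    have : ∃ k l : ℕ, k ≠ l ∧
        (fun k : ℕ => (m (ε / (k + 2)), decide (v (m (ε / (k + 2))) + ε / (k + 2) * w' (m (ε / (k + 2))) = 0))) k =
        (fun k : ℕ => (m (ε / (k + 2)), decide (v (m (ε / (k + 2))) + ε / (k + 2) * w' (m (ε / (k + 2))) = 0))) l :=
      Finite.exists_ne_map_eq_of_infinite _
    obtain ⟨k, l, hkl, he⟩ := this
    simp only [Prod.mk.injEq, decide_eq_decide] at he
    obtain ⟨he, he'⟩ := he
    have h1 := hm _ (hpos k).1 (hpos k).2
    have h2 := hm _ (hpos l).1 (hpos l).2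
    rw [← he] at h2 he'
    have hne : ε / ((k : ℝ) + 2) - ε / ((l : ℝ) + 2) ≠ 0 := by
      intro h
      rw [sub_eq_zero, div_eq_div_iff (by positivity) (by positivity)] at h
      have := mul_left_cancel₀ hε.ne' h
      exact hkl (by exact_mod_cast (by linarith : (k : ℝ) = l))
    have hval : v (m (ε / (k + 2))) + ε / (k + 2) * w' (m (ε / (k + 2))) =
        v (m (ε / (k + 2))) + ε / (l + 2) * w' (m (ε / (k + 2))) := by
      rcases h1 with h1 | h1 <;> rcases h2 with h2 | h2
      · rw [h1, h2]
      · rw [he'.1 h1] at h2; norm_num at h2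
      · rw [he'.2 h2] at h1; norm_num at h1
      · rw [h1, h2]
    have hz : w' (m (ε / (k + 2))) = 0 := by
      have : (ε / ((k : ℝ) + 2) - ε / ((l : ℝ) + 2)) * w' (m (ε / (k + 2))) = 0 := by linarith
      exact (mul_eq_zero.1 this).resolve_left hne
    refine ⟨_, ?_, hz⟩
    rw [hz] at h1
    simpa using h1
  · intro n hn
    have := ((hin (ε / 2) (by linarith) (by linarith)).1 n).1
    rw [hn, zero_add] at this
    exact nonneg_of_mul_nonneg_right this (by linarith)

theorem Departs.exists_dir {γ : ℝ → Space} (hγ : ∀ t, γ t ∈ surface) {t : ℝ} {w : Space}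
    (h : Departs γ t w) (F : Frame) {v : Fin 3 → ℝ} (hv : γ t = F.pt v) :
    ∃ w', w = F.vec w' ∧ ∑ n, w' n * w' n = 1 ∧ (∃ m, (v m = 0 ∨ v m = 1) ∧ w' m = 0) ∧
      (∀ n, v n = 0 → 0 ≤ w' n) := by
  refine exists_dir_of_segment F h.1 (h.2.mono fun s hs => ?_)
  rw [← hv, ← hs]
  exact hγ _

namespace IsSimpleClosedQuasigeodesic

variable {L : ℝ} {γ : ℝ → Space}

/-- The departing direction makes an angle of at least `π` (at a vertex, at least `π / 2`) with
the arriving one along every chain of sectors. -/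
theorem exists_departs (hγ : IsSimpleClosedQuasigeodesic L γ) {t : ℝ} {u : Space}
    (hu : Arrives γ t u) : ∃ w, Departs γ t w ∧ ∀ r, SectorChain (γ t) u w r →
      totalAngle (γ t) - Real.pi ≤ r := by
  obtain ⟨u', w, hu', hw, -, hl⟩ := hγ.quasigeodesic t
  obtain rfl := hu.unique hu'
  refine ⟨w, hw, fun r hr => ?_⟩
  have := smallerSide_le hr
  unfold largerSide at hl
  linarith

/-- The total angle is `2π`, so the single sector between the two directions must have angle `π`.
Equality in Cauchy–Schwarz then makes them opposite. -/
theorem departs_face (hγ : IsSimpleClosedQuasigeodesic L γ) (F : Frame) {t x y p q : ℝ}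
    (hx : x ∈ Set.Ioo (0 : ℝ) 1) (hy : y ∈ Set.Ioo (0 : ℝ) 1) (ht : γ t = F.pt ![x, y, 0])
    (hu : Arrives γ t (F.vec ![-p, -q, 0])) : Departs γ t (F.vec ![p, q, 0]) := by
  obtain ⟨w, hw, hr⟩ := hγ.exists_departs hu
  obtain ⟨w', rfl, hw1, ⟨m, hm, hm0⟩, -⟩ := hw.exists_dir hγ.mem_surface F ht
  have hnv : ¬ IsVertex (γ t) := by
    rw [ht, Frame.isVertex_pt]
    intro h
    have := h 0
    simp only [Matrix.cons_val_zero] at this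
    rcases this with h | h <;> linarith [hx.1, hx.2]
  rw [totalAngle, if_neg hnv] at hr
  have hw2 : w' 2 = 0 := by
    fin_cases m
    · simp at hm; rcases hm with h | h <;> linarith [hx.1, hx.2]
    · simp at hm; rcases hm with h | h <;> linarith [hy.1, hy.2]
    · exact hm0
  have hu1 := Frame.sum_of_norm hu.1
  have h01 : ∀ n, ![x, y, 0] n ∈ Set.Icc (0 : ℝ) 1 := by
    intro n; fin_cases n
    · exact ⟨hx.1.le, hx.2.le⟩
    · exact ⟨hy.1.le, hy.2.le⟩
    · simp
  have dir : ∀ z : Fin 3 → ℝ, z 2 = 0 → ∑ n, z n * z n = 1 →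
      IsFaceDir (F.2 2) (F.1 (F.2 2)) (γ t) (F.vec z) := by
    intro z hz hz1
    rw [ht]
    refine F.isFaceDir (by simp) hz hz1 h01 ?_ ?_ <;> intro n hn <;> fin_cases n <;> simp at hn
    · linarith [hx.1]
    · linarith [hy.1]
    · exact hz.ge
    · linarith [hx.2]
    · linarith [hy.2]
  have := hr _ (SectorChain.sector (dir _ (by simp) hu1) (dir _ hw2 hw1))
  have ha := (InnerProductGeometry.angle_le_pi _ _).antisymm (by linarith : Real.pi ≤ _)
  rw [F.angle_vec hu1 hw1, Real.arccos_eq_pi] at ha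
  simp only [Fin.sum_univ_three, Matrix.cons_val_zero, Matrix.cons_val_one, Matrix.cons_val,
    hw2] at ha hu1 hw1
  have e0 : w' 0 = p := by nlinarith [sq_nonneg (w' 0 - p), sq_nonneg (w' 1 - q)]
  have e1 : w' 1 = q := by nlinarith [sq_nonneg (w' 0 - p), sq_nonneg (w' 1 - q)]
  convert hw
  ext n; fin_cases n <;> simp [e0, e1, hw2]

end IsSimpleClosedQuasigeodesic

end local_rules

namespace Frame

/-- The same corner with the first and the third axis exchanged. -/
def flip (F : Frame) : Frame := (F.1, F.2 * Equiv.swap 0 2)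

theorem pt_flip (F : Frame) (x y z : ℝ) : F.flip.pt ![x, y, z] = F.pt ![z, y, x] := by
  have : ∀ n, ![x, y, z] ((F.2 * Equiv.swap 0 2).symm n) = ![z, y, x] (F.2.symm n) := by
    intro n
    obtain ⟨m, rfl⟩ := F.2.surjective n
    have h : (F.2 * Equiv.swap 0 2).symm (F.2 m) = Equiv.swap 0 2 m := by
      rw [Equiv.symm_apply_eq]; simp
    rw [h, Equiv.symm_apply_apply]
    fin_cases m <;> simp [Equiv.swap_apply_def]
  ext n
  simp only [pt, flip, this]

theorem vec_flip (F : Frame) (x y z : ℝ) : F.flip.vec ![x, y, z] = F.vec ![z, y, x] := by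
  have : ∀ n, ![x, y, z] ((F.2 * Equiv.swap 0 2).symm n) = ![z, y, x] (F.2.symm n) := by
    intro n
    obtain ⟨m, rfl⟩ := F.2.surjective n
    have h : (F.2 * Equiv.swap 0 2).symm (F.2 m) = Equiv.swap 0 2 m := by
      rw [Equiv.symm_apply_eq]; simp
    rw [h, Equiv.symm_apply_apply]
    fin_cases m <;> simp [Equiv.swap_apply_def]
  ext n
  simp only [vec, flip, this]

end Frame

/-- For unit vectors, an inequality between sines becomes one between slopes, written without
division. -/
theorem mul_le_mul_of_unit {p q r s : ℝ} (hp : 0 ≤ p) (hr : 0 ≤ r) (hs : 0 ≤ s)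
    (h1 : p * p + q * q = 1) (h2 : r * r + s * s = 1) (hqs : q ≤ s) : q * r ≤ s * p := by
  rcases le_or_gt q 0 with hq | hq
  · exact (mul_nonpos_of_nonpos_of_nonneg hq hr).trans (mul_nonneg hs hp)
  · have : r ≤ p := abs_le_of_sq_le_sq (by nlinarith) hp |> (le_abs_self r).trans
    exact mul_le_mul hqs this hr hs

/-- The hypothesis says `arcsin a ≤ arccos c`; apply the sine, which is monotone here and sends the
right side to `s`. -/
theorem le_of_arccos_add {a c s : ℝ} (ha : a ∈ Set.Icc (-1 : ℝ) 1) (hs : 0 ≤ s)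
    (hc0 : 0 ≤ c) (hc : c * c + s * s = 1) (h : Real.pi / 2 ≤ Real.arccos a + Real.arccos c) : a ≤ s := by
  have h0 : Real.sqrt (1 - c ^ 2) = s := by
    rw [show 1 - c ^ 2 = s ^ 2 by linarith, Real.sqrt_sq hs]
  have h1 : Real.arcsin a ≤ Real.arccos c := by
    rw [Real.arccos] at h; linarith
  rw [← Real.sin_arcsin ha.1 ha.2, ← h0, ← Real.sin_arccos]
  exact Real.sin_le_sin_of_le_of_le_pi_div_two (Real.neg_pi_div_two_le_arcsin a)
    (Real.arccos_le_pi_div_two.2 hc0) h1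

namespace IsSimpleClosedQuasigeodesic

variable {L : ℝ} {γ : ℝ → Space}

/-- Turning into the other face through either end of the edge gives two chains whose angles sum to
`2π`. Both are at least `π`, so both equal `π`. Staying in the same face requires opposite
directions, which is possible only along the edge itself. -/
theorem departs_edge (hγ : IsSimpleClosedQuasigeodesic L γ) (F : Frame) {t y p q : ℝ}
    (hy : y ∈ Set.Ioo (0 : ℝ) 1) (ht : γ t = F.pt ![0, y, 0]) (hp : 0 ≤ p)
    (hu : Arrives γ t (F.vec ![p, q, 0])) : Departs γ t (F.vec ![0, -q, p]) := by
  obtain ⟨w, hw, hr⟩ := hγ.exists_departs hu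
  obtain ⟨w', rfl, hw1, ⟨m, hm, hm0⟩, hw0⟩ := hw.exists_dir hγ.mem_surface F ht
  have hnv : ¬ IsVertex (γ t) := by
    rw [ht, Frame.isVertex_pt]
    intro h
    have := h 1
    simp only [Matrix.cons_val_one, Matrix.cons_val_zero] at this
    rcases this with h | h <;> linarith [hy.1, hy.2]
  rw [totalAngle, if_neg hnv] at hr
  have hu1 := Frame.sum_of_norm hu.1
  have h01 : ∀ n, ![0, y, 0] n ∈ Set.Icc (0 : ℝ) 1 := by
    intro n; fin_cases n
    · simp
    · exact ⟨hy.1.le, hy.2.le⟩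
    · simp
  have dir : ∀ (k : Fin 3) (z : Fin 3 → ℝ), k ≠ 1 → z k = 0 → ∑ n, z n * z n = 1 → 0 ≤ z 0 →
      0 ≤ z 2 → IsFaceDir (F.2 k) (F.1 (F.2 k)) (γ t) (F.vec z) := by
    intro k z hk hz hz1 hz0 hz2
    rw [ht]
    refine F.isFaceDir (by fin_cases k <;> simp at hk ⊢) hz hz1 h01 ?_ ?_ <;>
      intro n hn <;> fin_cases n <;> simp at hn
    · exact hz0
    · linarith [hy.1]
    · exact hz2
    · linarith [hy.2]
  have w0 : 0 ≤ w' 0 := hw0 0 (by simp)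
  have w2 : 0 ≤ w' 2 := hw0 2 (by simp)
  have hE : ∑ n, (![0, 1, 0] : Fin 3 → ℝ) n * ![0, 1, 0] n = 1 := by
    simp [Fin.sum_univ_three]
  have hE' : ∑ n, (![0, -1, 0] : Fin 3 → ℝ) n * ![0, -1, 0] n = 1 := by
    simp [Fin.sum_univ_three]
  have du := dir 2 ![p, q, 0] (by simp) (by simp) hu1 hp (by simp)
  suffices h : w' 0 = 0 ∧ w' 1 = -q ∧ w' 2 = p by
    convert hw
    ext n; fin_cases n <;> simp [h]
  have hm' : w' 2 = 0 ∨ w' 0 = 0 := by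
    fin_cases m
    · exact Or.inr hm0
    · simp at hm; rcases hm with h | h <;> linarith [hy.1, hy.2]
    · exact Or.inl hm0
  rcases hm' with h2 | h0
  · have := hr _ (SectorChain.sector du (dir 2 w' (by simp) h2 hw1 w0 w2))
    have ha := (InnerProductGeometry.angle_le_pi _ _).antisymm (by linarith : Real.pi ≤ _)
    rw [F.angle_vec hu1 hw1, Real.arccos_eq_pi] at ha
    simp only [Fin.sum_univ_three, Matrix.cons_val_zero, Matrix.cons_val_one, Matrix.cons_val,
      h2] at ha hu1 hw1
    have e0 : w' 0 = -p := by nlinarith [sq_nonneg (w' 0 + p), sq_nonneg (w' 1 + q)]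
    have e1 : w' 1 = -q := by nlinarith [sq_nonneg (w' 0 + p), sq_nonneg (w' 1 + q)]
    exact ⟨by linarith, e1, by linarith⟩
  · have h1 := hr _ (SectorChain.cons du
      (dir 2 ![0, 1, 0] (by simp) (by simp) hE (by simp) (by simp))
      (SectorChain.sector (dir 0 ![0, 1, 0] (by simp) (by simp) hE (by simp) (by simp))
        (dir 0 w' (by simp) h0 hw1 w0 w2)))
    have h2 := hr _ (SectorChain.cons du
      (dir 2 ![0, -1, 0] (by simp) (by simp) hE' (by simp) (by simp))
      (SectorChain.sector (dir 0 ![0, -1, 0] (by simp) (by simp) hE' (by simp) (by simp))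
        (dir 0 w' (by simp) h0 hw1 w0 w2)))
    rw [F.angle_vec hu1 hE, F.angle_vec hE hw1] at h1
    rw [F.angle_vec hu1 hE', F.angle_vec hE' hw1] at h2
    simp only [Fin.sum_univ_three, Matrix.cons_val_zero, Matrix.cons_val_one, Matrix.cons_val,
      h0] at h1 h2 hu1 hw1
    have e1 : Real.arccos (q * 1 * 1) + Real.arccos (w' 1) = Real.pi := by
      ring_nf at h1 h2 ⊢
      rw [Real.arccos_neg, Real.arccos_neg] at h2
      linarith
    have e2 : Real.arccos (w' 1) = Real.arccos (-q) := by
      rw [Real.arccos_neg]; ring_nf at e1 ⊢; linarith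
    have e3 : w' 1 = -q := by
      have := congrArg Real.cos e2
      rwa [Real.cos_arccos, Real.cos_arccos] at this <;> nlinarith [mul_self_nonneg p, mul_self_nonneg (w' 2)]
    refine ⟨h0, e3, ?_⟩
    rw [e3] at hw1
    nlinarith

theorem departs_edge' (hγ : IsSimpleClosedQuasigeodesic L γ) (F : Frame) {t y p q : ℝ}
    (hy : y ∈ Set.Ioo (0 : ℝ) 1) (ht : γ t = F.pt ![0, y, 0]) (hp : 0 ≤ p)
    (hu : Arrives γ t (F.vec ![0, q, p])) : Departs γ t (F.vec ![p, -q, 0]) := by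
  rw [← Frame.pt_flip] at ht
  rw [← Frame.vec_flip] at hu ⊢
  exact hγ.departs_edge F.flip hy ht hp hu

/-- With total angle `3π/2`, every chain must measure at least `π/2`. For each of the two other
faces only the chain through the axis shared with the arrival face matters, since the other chain
contains a whole right angle anyway. The two product inequalities are these bounds in terms of
slopes. -/
theorem departs_vertex (hγ : IsSimpleClosedQuasigeodesic L γ) (F : Frame) {t p q : ℝ}
    (ht : γ t = F.pt ![0, 0, 0]) (hp : 0 < p) (hq : 0 ≤ q)
    (hu : Arrives γ t (F.vec ![p, 0, q])) :
    ∃ p' q', 0 ≤ p' ∧ 0 ≤ q' ∧ p' * p' + q' * q' = 1 ∧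
      (p' * q ≤ q' * p ∧ Departs γ t (F.vec ![0, q', p']) ∨
        p * q' ≤ p' * q ∧ Departs γ t (F.vec ![q', p', 0])) := by
  obtain ⟨w, hw, hr⟩ := hγ.exists_departs hu
  obtain ⟨w', rfl, hw1, ⟨m, hm, hm0⟩, hw0⟩ := hw.exists_dir hγ.mem_surface F ht
  have hnv : IsVertex (γ t) := by
    rw [ht, Frame.isVertex_pt]
    intro n; fin_cases n <;> simp
  rw [totalAngle, if_pos hnv] at hr
  have hu1 := Frame.sum_of_norm hu.1
  have dir : ∀ (k : Fin 3) (z : Fin 3 → ℝ), z k = 0 → ∑ n, z n * z n = 1 → (∀ n, 0 ≤ z n) →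
      IsFaceDir (F.2 k) (F.1 (F.2 k)) (γ t) (F.vec z) := by
    intro k z hz hz1 hz0
    rw [ht]
    refine F.isFaceDir (by fin_cases k <;> simp) hz hz1 ?_ ?_ ?_ <;>
      intro n
    · fin_cases n <;> simp
    · exact fun _ => hz0 n
    · intro hn; fin_cases n <;> simp at hn
  have hw0 : ∀ n, 0 ≤ w' n := fun n => hw0 n (by fin_cases n <;> simp)
  have hu0 : ∀ n, 0 ≤ ![p, 0, q] n := by intro n; fin_cases n <;> simp [hp.le, hq]
  have hA : ∑ n, (![1, 0, 0] : Fin 3 → ℝ) n * ![1, 0, 0] n = 1 := by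
    simp [Fin.sum_univ_three]
  have hB : ∑ n, (![0, 0, 1] : Fin 3 → ℝ) n * ![0, 0, 1] n = 1 := by
    simp [Fin.sum_univ_three]
  have hA0 : ∀ n, (0 : ℝ) ≤ ![1, 0, 0] n := by intro n; fin_cases n <;> simp
  have hB0 : ∀ n, (0 : ℝ) ≤ ![0, 0, 1] n := by intro n; fin_cases n <;> simp
  have du := dir 1 ![p, 0, q] (by simp) hu1 hu0
  fin_cases m <;> simp only [Fin.zero_eta, Fin.mk_one, Fin.reduceFinMk] at hm0
  · refine ⟨w' 2, w' 1, hw0 2, hw0 1, ?_, Or.inl ⟨?_, ?_⟩⟩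
    · simp only [Fin.sum_univ_three, hm0] at hw1; linarith
    · have h1 := hr _ (SectorChain.cons du (dir 1 ![0, 0, 1] (by simp) hB hB0)
        (SectorChain.sector (dir 0 ![0, 0, 1] (by simp) hB hB0) (dir 0 w' hm0 hw1 hw0)))
      rw [F.angle_vec hu1 hB, F.angle_vec hB hw1] at h1
      simp only [Fin.sum_univ_three, Matrix.cons_val_zero, Matrix.cons_val_one, Matrix.cons_val,
        hm0] at h1 hu1 hw1
      have := le_of_arccos_add (a := q) (c := w' 2) (s := w' 1)
        ⟨by linarith, by nlinarith⟩ (hw0 1) (hw0 _) (by linarith) (by ring_nf at h1 ⊢; linarith)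
      have := mul_le_mul_of_unit (r := w' 2) hp.le (hw0 2) (hw0 1) (by linarith : p * p + q * q = 1)
        (by linarith) this
      linarith
    · convert hw; ext n; fin_cases n <;> simp [hm0]
  -- Staying in the arrival face requires perpendicular directions in one quadrant. As `p > 0`, the
  -- curve arrives along one edge and leaves along another, which also bounds the face `x = 0`.
  · have h1 := hr _ (SectorChain.sector du (dir 1 w' hm0 hw1 hw0))
    rw [F.angle_vec hu1 hw1] at h1
    simp only [Fin.sum_univ_three, Matrix.cons_val_zero, Matrix.cons_val_one, Matrix.cons_val,
      hm0] at h1 hu1 hw1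
    have h3 : p * w' 0 + q * w' 2 ≤ 0 := by
      by_contra hn
      have := Real.arccos_lt_pi_div_two.2 (not_le.1 hn)
      ring_nf at h1 this; linarith
    have w00 : w' 0 = 0 := by
      have := mul_nonneg hq (hw0 2)
      have h4 := hw0 0
      nlinarith
    have w21 : w' 2 = 1 := by rw [w00] at hw1; nlinarith [hw0 2]
    have hq0 : q = 0 := by rw [w00, w21] at h3; linarith
    refine ⟨1, 0, zero_le_one, le_rfl, by norm_num, Or.inl ⟨by simp [hq0], ?_⟩⟩
    convert hw; ext n; fin_cases n <;> simp [hm0, w00, w21]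
  · refine ⟨w' 1, w' 0, hw0 1, hw0 0, ?_, Or.inr ⟨?_, ?_⟩⟩
    · simp only [Fin.sum_univ_three, hm0] at hw1; linarith
    · have h1 := hr _ (SectorChain.cons du (dir 1 ![1, 0, 0] (by simp) hA hA0)
        (SectorChain.sector (dir 2 ![1, 0, 0] (by simp) hA hA0) (dir 2 w' hm0 hw1 hw0)))
      rw [F.angle_vec hu1 hA, F.angle_vec hA hw1] at h1
      simp only [Fin.sum_univ_three, Matrix.cons_val_zero, Matrix.cons_val_one, Matrix.cons_val,
        hm0] at h1 hu1 hw1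
      have := le_of_arccos_add (a := p) (c := w' 0) (s := w' 1)
        ⟨by linarith, by nlinarith⟩ (hw0 1) (hw0 _) (by linarith) (by ring_nf at h1 ⊢; linarith)
      have := mul_le_mul_of_unit (r := w' 0) hq (hw0 0) (hw0 1) (by linarith : q * q + p * p = 1)
        (by linarith) this
      linarith
    · convert hw; ext n; fin_cases n <;> simp [hm0]

end IsSimpleClosedQuasigeodesic

/-! ### Effect of rolling, turning and exchanging axes on coordinates. -/

namespace Frame

theorem pt_comp (F : Frame) (τ : Equiv.Perm (Fin 3)) (v : Fin 3 → ℝ) :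
    Frame.pt (F.1, F.2 * τ) v = F.pt (v ∘ τ.symm) := rfl

theorem vec_comp (F : Frame) (τ : Equiv.Perm (Fin 3)) (v : Fin 3 → ℝ) :
    Frame.vec (F.1, F.2 * τ) v = F.vec (v ∘ τ.symm) := rfl

theorem pt_move (F : Frame) (k l : Fin 3) (v : Fin 3 → ℝ) :
    (move k l F).pt v =
      F.pt (Function.update (v ∘ Equiv.swap k l) k (1 - v l)) := by
  ext n
  obtain ⟨m, rfl⟩ := F.2.surjective n
  have h : (F.2 * Equiv.swap k l).symm (F.2 m) = Equiv.swap k l m := by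
    rw [Equiv.symm_apply_eq]; simp
  simp only [pt, move, h, Equiv.symm_apply_apply]
  by_cases hm : m = k
  · subst hm
    cases F.1 (F.2 m) <;> simp
  · have : F.2 m ≠ F.2 k := fun h => hm (F.2.injective h)
    rw [Function.update_of_ne this, Function.update_of_ne hm]
    rfl

theorem vec_move (F : Frame) (k l : Fin 3) (v : Fin 3 → ℝ) :
    (move k l F).vec v =
      F.vec (Function.update (v ∘ Equiv.swap k l) k (-v l)) := by
  ext n
  obtain ⟨m, rfl⟩ := F.2.surjective n
  have h : (F.2 * Equiv.swap k l).symm (F.2 m) = Equiv.swap k l m := by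
    rw [Equiv.symm_apply_eq]; simp
  simp only [vec, move, h, Equiv.symm_apply_apply]
  by_cases hm : m = k
  · subst hm
    cases F.1 (F.2 m) <;> simp
  · have : F.2 m ≠ F.2 k := fun h => hm (F.2.injective h)
    rw [Function.update_of_ne this, Function.update_of_ne hm]
    rfl

theorem pt_right (F : Frame) (x y z : ℝ) : (right F).pt ![x, y, z] = F.pt ![1 - z, y, x] := by
  refine (F.pt_move 0 2 _).trans (congrArg F.pt ?_)
  ext n; fin_cases n <;> simp [Equiv.swap_apply_def]

theorem vec_right (F : Frame) (x y z : ℝ) : (right F).vec ![x, y, z] = F.vec ![-z, y, x] := by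
  refine (F.vec_move 0 2 _).trans (congrArg F.vec ?_)
  ext n; fin_cases n <;> simp [Equiv.swap_apply_def]

theorem pt_up (F : Frame) (x y z : ℝ) : (up F).pt ![x, y, z] = F.pt ![x, 1 - z, y] := by
  refine (F.pt_move 1 2 _).trans (congrArg F.pt ?_)
  ext n; fin_cases n <;> simp [Equiv.swap_apply_def]

theorem vec_up (F : Frame) (x y z : ℝ) : (up F).vec ![x, y, z] = F.vec ![x, -z, y] := by
  refine (F.vec_move 1 2 _).trans (congrArg F.vec ?_)
  ext n; fin_cases n <;> simp [Equiv.swap_apply_def]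

theorem pt_turn (F : Frame) (x y z : ℝ) : (turn F).pt ![x, y, z] = F.pt ![y, 1 - x, z] := by
  refine (F.pt_move 1 0 _).trans (congrArg F.pt ?_)
  ext n; fin_cases n <;> simp [Equiv.swap_apply_def]

theorem vec_turn (F : Frame) (x y z : ℝ) : (turn F).vec ![x, y, z] = F.vec ![y, -x, z] := by
  refine (F.vec_move 1 0 _).trans (congrArg F.vec ?_)
  ext n; fin_cases n <;> simp [Equiv.swap_apply_def]

/-- The same corner with the first two axes exchanged. -/
def swap (F : Frame) : Frame := (F.1, F.2 * Equiv.swap 0 1)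

theorem pt_swap (F : Frame) (x y z : ℝ) : F.swap.pt ![x, y, z] = F.pt ![y, x, z] := by
  refine (F.pt_comp _ _).trans (congrArg F.pt ?_)
  ext n; fin_cases n <;> simp [Equiv.swap_apply_def]

theorem vec_swap (F : Frame) (x y z : ℝ) : F.swap.vec ![x, y, z] = F.vec ![y, x, z] := by
  refine (F.vec_comp _ _).trans (congrArg F.vec ?_)
  ext n; fin_cases n <;> simp [Equiv.swap_apply_def]

theorem pt_add_vec (F : Frame) (x y p q s : ℝ) :
    F.pt ![x, y, 0] + s • F.vec ![p, q, 0] = F.pt ![x + s * p, y + s * q, 0] := by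
  rw [pt_add_smul_vec]
  congr 1; ext n; fin_cases n <;> simp

theorem norm_vec_pair (F : Frame) {p q : ℝ} (h : p * p + q * q = 1) :
    ‖F.vec ![p, q, 0]‖ = 1 := norm_vec_eq_one (by simpa [Fin.sum_univ_three] using h)

end Frame

/-! ### Consequences of simplicity, and propagation along forced curves. -/

section curves

theorem eq_of_eventually_affine {P Q u v : Space}
    (h : ∀ᶠ s in 𝓝[>] (0 : ℝ), P + s • u = Q + s • v) : P = Q ∧ u = v := by
  have lim : ∀ P u : Space, Tendsto (fun s : ℝ => P + s • u) (𝓝[>] 0) (𝓝 P) := fun P u => by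
    have : Continuous fun s : ℝ => P + s • u := by fun_prop
    simpa using (this.tendsto 0).mono_left nhdsWithin_le_nhds
  have hPQ : P = Q := tendsto_nhds_unique ((lim P u).congr' h) (lim Q v)
  obtain ⟨s, hs, h0⟩ := (h.and self_mem_nhdsWithin).exists
  have h0 : 0 < s := h0
  rw [hPQ] at hs
  exact ⟨hPQ, smul_right_injective _ h0.ne' (add_left_cancel hs)⟩

theorem eventually_nhdsGT_of_nhdsGE {p : ℝ → Prop} (h : ∀ᶠ s in 𝓝[≥] (0 : ℝ), p s) :
    ∀ᶠ s in 𝓝[>] (0 : ℝ), p s :=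
  h.filter_mono (nhdsWithin_mono 0 Set.Ioi_subset_Ici_self)

namespace IsSimpleClosedQuasigeodesic

variable {L : ℝ} {γ : ℝ → Space}

theorem exists_arrives (hγ : IsSimpleClosedQuasigeodesic L γ) (t : ℝ) : ∃ u, Arrives γ t u := by
  obtain ⟨u, w, hu, -⟩ := hγ.quasigeodesic t
  exact ⟨u, hu⟩

/-- This is the form in which simplicity is used: two visits to one point differ by a period, so
they share their arriving and departing directions. -/
theorem eq_add_of_eq (hγ : IsSimpleClosedQuasigeodesic L γ) {t t' : ℝ} (h : γ t = γ t') :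
    ∃ P, t' = t + P ∧ Function.Periodic γ P := by
  have e : ∀ t, γ (toIcoMod hγ.length_pos 0 t) = γ t := fun t => by
    rw [toIcoMod]; exact hγ.closed.sub_zsmul_eq _
  have m : ∀ t, toIcoMod hγ.length_pos 0 t ∈ Set.Ico 0 L := fun t => by
    simpa using toIcoMod_mem_Ico hγ.length_pos 0 t
  have := hγ.simple (m t) (m t') (by rw [e, e, h])
  refine ⟨(toIcoDiv hγ.length_pos 0 t' - toIcoDiv hγ.length_pos 0 t) • L, ?_,
    hγ.closed.zsmul _⟩
  rw [toIcoMod, toIcoMod] at this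
  rw [sub_smul]; linarith

theorem departs_of_eq (hγ : IsSimpleClosedQuasigeodesic L γ) {t t' : ℝ} {w : Space}
    (h : γ t = γ t') (hw : Departs γ t w) : Departs γ t' w := by
  obtain ⟨P, rfl, hP⟩ := hγ.eq_add_of_eq h
  refine ⟨hw.1, hw.2.mono fun s hs => ?_⟩
  rw [add_right_comm, hP, hP, hs]

theorem arrives_of_eq (hγ : IsSimpleClosedQuasigeodesic L γ) {t t' : ℝ} {w : Space}
    (h : γ t = γ t') (hw : Arrives γ t w) : Arrives γ t' w := by
  obtain ⟨P, rfl, hP⟩ := hγ.eq_add_of_eq h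
  refine ⟨hw.1, hw.2.mono fun s hs => ?_⟩
  rw [add_sub_right_comm, hP, hP, hs]

/-- The curve reaches the limit of a straight line that it follows. -/
theorem arrives_of_eventually (hγ : IsSimpleClosedQuasigeodesic L γ) {t : ℝ} {P u : Space}
    (h : ∀ᶠ s in 𝓝[>] (0 : ℝ), γ (t - s) = P + s • u) : γ t = P ∧ Arrives γ t u := by
  obtain ⟨u', hu'⟩ := hγ.exists_arrives t
  obtain ⟨rfl, rfl⟩ := eq_of_eventually_affine
    (h.mp ((eventually_nhdsGT_of_nhdsGE hu'.2).mono fun s h1 h2 => h1.symm.trans h2))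
  exact ⟨rfl, hu'⟩

/-- Consider the infimum `c` of the times of disagreement. Agreement before `c` fixes the point and
the arriving direction at `c`, since `γ` has an arriving direction there. The forced departure then
extends the agreement beyond `c`. -/
theorem eqOn_of_forced (hγ : IsSimpleClosedQuasigeodesic L γ) {δ : ℝ → Space} {t ℓ : ℝ}
    {w₀ : Space} (h0 : γ t = δ 0) (hw₀ : Departs γ t w₀) (hw₀' : Departs δ 0 w₀)
    (h : ∀ s ∈ Set.Ioo 0 ℓ, ∃ u w, Arrives δ s u ∧ Departs δ s w ∧
      ∀ t, γ t = δ s → Arrives γ t u → Departs γ t w) :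
    ∀ s ∈ Set.Ico 0 ℓ, γ (t + s) = δ s := by
  by_contra hcon
  push Not at hcon
  set B := {s | s ∈ Set.Ico 0 ℓ ∧ γ (t + s) ≠ δ s} with hB
  have hBne : B.Nonempty := hcon
  have hbdd : BddBelow B := ⟨0, fun s hs => hs.1.1⟩
  set c := sInf B with hc
  have hc0 : 0 ≤ c := le_csInf hBne fun s hs => hs.1.1
  have hcl : c < ℓ := by
    obtain ⟨s, hs⟩ := hBne
    exact (csInf_le hbdd hs).trans_lt hs.1.2
  have hlt : ∀ s, 0 ≤ s → s < c → γ (t + s) = δ s := fun s h0 h1 => by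
    by_contra hne
    exact absurd (csInf_le hbdd (show s ∈ B from ⟨⟨h0, h1.trans hcl⟩, hne⟩)) (not_le.2 h1)
  have key : ∃ w, γ (t + c) = δ c ∧ Departs γ (t + c) w ∧ Departs δ c w := by
    rcases hc0.eq_or_lt with hc0 | hc0
    · rw [← hc0, add_zero]
      exact ⟨w₀, h0, hw₀, hw₀'⟩
    · obtain ⟨u, w, hu, hw, hf⟩ := h c ⟨hc0, hcl⟩
      have : γ (t + c) = δ c ∧ Arrives γ (t + c) u := by
        refine hγ.arrives_of_eventually ?_
        filter_upwards [eventually_nhdsGT_of_nhdsGE hu.2, Ioo_mem_nhdsGT hc0] with s hs hs'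
        rw [← hs, add_sub_assoc]
        exact hlt _ (by linarith [hs'.2]) (by linarith [hs'.1])
      exact ⟨w, this.1, hf _ this.1 this.2, hw⟩
  obtain ⟨w, he, h1, h2⟩ := key
  obtain ⟨ε, hε, hS⟩ := (mem_nhdsGE_iff_exists_Ico_subset).1 (h1.2.and h2.2)
  have hε : 0 < ε := hε
  have : c + ε ≤ c := by
    refine le_csInf hBne fun s hs => ?_
    by_contra hlt'
    have hcs := csInf_le hbdd hs
    obtain ⟨e1, e2⟩ := hS (show s - c ∈ Set.Ico 0 ε from ⟨by linarith, by linarith⟩)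
    apply hs.2
    have e1 : γ (t + c + (s - c)) = γ (t + c) + (s - c) • w := e1
    have e2 : δ (c + (s - c)) = δ c + (s - c) • w := e2
    rw [he, ← e2] at e1
    convert e1 using 2 <;> ring
  linarith

/-- The curve continues straight over an edge of the cube. -/
theorem departs_right (hγ : IsSimpleClosedQuasigeodesic L γ) (F : Frame) {t y p q : ℝ}
    (hy : y ∈ Set.Ioo (0 : ℝ) 1) (ht : γ t = F.pt ![1, y, 0]) (hp : 0 ≤ p) :
    (Arrives γ t (F.vec ![-p, -q, 0]) → Departs γ t ((Frame.right F).vec ![p, q, 0])) ∧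
    (Arrives γ t ((Frame.right F).vec ![p, q, 0]) → Departs γ t (F.vec ![-p, -q, 0])) := by
  have ht' : γ t = (Frame.right F).pt ![0, y, 0] := by rw [Frame.pt_right, sub_zero, ht]
  have e : F.vec ![-p, -q, 0] = (Frame.right F).vec ![0, -q, p] := by rw [Frame.vec_right]
  rw [e]
  refine ⟨fun h => ?_, fun h => ?_⟩
  · simpa using hγ.departs_edge' _ hy ht' hp h
  · exact hγ.departs_edge _ hy ht' hp h

theorem departs_up (hγ : IsSimpleClosedQuasigeodesic L γ) (F : Frame) {t x p q : ℝ}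
    (hx : x ∈ Set.Ioo (0 : ℝ) 1) (ht : γ t = F.pt ![x, 1, 0]) (hq : 0 ≤ q) :
    (Arrives γ t (F.vec ![-p, -q, 0]) → Departs γ t ((Frame.up F).vec ![p, q, 0])) ∧
    (Arrives γ t ((Frame.up F).vec ![p, q, 0]) → Departs γ t (F.vec ![-p, -q, 0])) := by
  have e : F.vec ![-p, -q, 0] = (Frame.right F.swap).vec ![0, -p, q] := by
    rw [Frame.vec_right, Frame.vec_swap]
  have e' : (Frame.up F).vec ![p, q, 0] = (Frame.right F.swap).vec ![q, p, 0] := by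
    rw [Frame.vec_right, Frame.vec_swap, Frame.vec_up]
  have ht' : γ t = (Frame.right F.swap).pt ![0, x, 0] := by
    rw [Frame.pt_right, Frame.pt_swap, sub_zero, ht]
  rw [e, e']
  refine ⟨fun h => ?_, fun h => ?_⟩
  · simpa using hγ.departs_edge' _ hx ht' hq h
  · exact hγ.departs_edge _ hx ht' hq h

end IsSimpleClosedQuasigeodesic
end curves

/-! ### Unfolding the lattice plane onto the cube. -/

section development

/-- The unfolding of the lattice plane onto the cube, one frame for each lattice square. -/
def dev (fr : ℤ → ℤ → Frame) (X : ℝ × ℝ) : Space :=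
  (fr ⌊X.1⌋ ⌊X.2⌋).pt ![Int.fract X.1, Int.fract X.2, 0]

/-- Near `X` the unfolding is isometric: `X` is no lattice point, and if it is on a lattice edge,
then the frames of the two squares roll onto each other. -/
def Good (fr : ℤ → ℤ → Frame) (X : ℝ × ℝ) : Prop :=
  (∀ i : ℤ, X.1 = i → ∃ j : ℤ, j < X.2 ∧ X.2 < j + 1 ∧ fr i j = Frame.right (fr (i - 1) j)) ∧
  (∀ j : ℤ, X.2 = j → ∃ i : ℤ, i < X.1 ∧ X.1 < i + 1 ∧ fr i j = Frame.up (fr i (j - 1)))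

/-- The index of the unit interval that one enters from `x` in direction `p`. -/
def side (x p : ℝ) : ℤ := if p < 0 then ⌈x⌉ - 1 else ⌊x⌋

/-- The direction on the cube that corresponds to the direction `d` at `X`. -/
def fwd (fr : ℤ → ℤ → Frame) (X d : ℝ × ℝ) : Space :=
  (fr (side X.1 d.1) (side X.2 d.2)).vec ![d.1, d.2, 0]

theorem side_le (x p : ℝ) : (side x p : ℝ) ≤ x ∧ x ≤ side x p + 1 := by
  unfold side
  split_ifs
  · push_cast; constructor <;> linarith [Int.le_ceil x, Int.ceil_lt_add_one x]
  · constructor <;> linarith [Int.floor_le x, Int.lt_floor_add_one x]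

theorem floor_add_eventually (x p : ℝ) : ∀ᶠ s in 𝓝[>] (0 : ℝ), ⌊x + s * p⌋ = side x p := by
  have lim : Tendsto (fun s : ℝ => x + s * p) (𝓝[>] 0) (𝓝 x) := by
    have : Continuous fun s : ℝ => x + s * p := by fun_prop
    simpa using (this.tendsto 0).mono_left nhdsWithin_le_nhds
  unfold side
  split_ifs with hp
  · have h1 : ((⌈x⌉ - 1 : ℤ) : ℝ) < x := by push_cast; linarith [Int.ceil_lt_add_one x]
    filter_upwards [lim.eventually (lt_mem_nhds h1), self_mem_nhdsWithin] with s hs h0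
    have h0 : 0 < s := h0
    rw [Int.floor_eq_iff]
    refine ⟨hs.le, ?_⟩
    push_cast
    nlinarith [Int.le_ceil x]
  · filter_upwards [lim.eventually (gt_mem_nhds (Int.lt_floor_add_one x)),
      self_mem_nhdsWithin] with s hs h0
    have h0 : 0 < s := h0
    rw [Int.floor_eq_iff]
    exact ⟨by nlinarith [Int.floor_le x, not_lt.1 hp], hs⟩

theorem side_eq_of_mem {x p : ℝ} {i : ℤ} (h : (i : ℝ) < x) (h' : x < i + 1) : side x p = i := by
  unfold side
  split_ifs
  · have : ⌈x⌉ = i + 1 := by rw [Int.ceil_eq_iff]; push_cast; exact ⟨by linarith, h'.le⟩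
    omega
  · rw [Int.floor_eq_iff]; exact ⟨h.le, h'⟩

theorem dev_of_mem {fr : ℤ → ℤ → Frame} {X : ℝ × ℝ} {i j : ℤ} (h1 : ⌊X.1⌋ = i) (h2 : ⌊X.2⌋ = j) :
    dev fr X = (fr i j).pt ![X.1 - i, X.2 - j, 0] := by
  rw [dev, h1, h2, Int.fract, Int.fract, h1, h2]

/-- The floor assigns a point on a lattice edge to one of two squares. Because their frames roll
onto each other, the other closed square gives the same point. -/
theorem Good.dev_eq {fr : ℤ → ℤ → Frame} {X : ℝ × ℝ} (h : Good fr X) {i j : ℤ}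
    (h1 : (i : ℝ) ≤ X.1) (h2 : X.1 ≤ i + 1) (h3 : (j : ℝ) ≤ X.2) (h4 : X.2 ≤ j + 1) :
    dev fr X = (fr i j).pt ![X.1 - i, X.2 - j, 0] := by
  rcases h2.eq_or_lt with h2 | h2
  · obtain ⟨j', hj1, hj2, hr⟩ := h.1 (i + 1) (by push_cast; exact h2)
    obtain rfl : j = j' := by
      have : (j : ℝ) < j' + 1 := h3.trans_lt hj2
      have : (j' : ℝ) < j + 1 := hj1.trans_le h4
      have : j < j' + 1 := by exact_mod_cast ‹(j : ℝ) < j' + 1›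
      have : j' < j + 1 := by exact_mod_cast ‹(j' : ℝ) < j + 1›
      omega
    have f1 : ⌊X.1⌋ = i + 1 := by rw [h2]; exact_mod_cast Int.floor_intCast (R := ℝ) (i + 1)
    have f2 : ⌊X.2⌋ = j := by rw [Int.floor_eq_iff]; exact ⟨h3, hj2⟩
    rw [dev_of_mem f1 f2, hr, Frame.pt_right, h2, add_sub_cancel_right]
    push_cast
    ring_nf
  · have f1 : ⌊X.1⌋ = i := by rw [Int.floor_eq_iff]; exact ⟨h1, h2⟩
    rcases h4.eq_or_lt with h4 | h4
    · obtain ⟨i', hi1, hi2, hr⟩ := h.2 (j + 1) (by push_cast; exact h4)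
      obtain rfl : i = i' := by
        rw [← f1, Int.floor_eq_iff]; exact ⟨hi1.le, hi2⟩
      have f2 : ⌊X.2⌋ = j + 1 := by rw [h4]; exact_mod_cast Int.floor_intCast (R := ℝ) (j + 1)
      rw [dev_of_mem f1 f2, hr, Frame.pt_up, h4, add_sub_cancel_right]
      push_cast
      ring_nf
    · exact dev_of_mem f1 (by rw [Int.floor_eq_iff]; exact ⟨h3, h4⟩)

theorem norm_fwd (fr : ℤ → ℤ → Frame) (X : ℝ × ℝ) {d : ℝ × ℝ} (hd : d.1 * d.1 + d.2 * d.2 = 1) :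
    ‖fwd fr X d‖ = 1 := Frame.norm_vec_pair _ hd

theorem Good.departs {fr : ℤ → ℤ → Frame} {X : ℝ × ℝ} (h : Good fr X) (d : ℝ × ℝ) :
    ∀ᶠ s in 𝓝[≥] (0 : ℝ), dev fr (X + s • d) = dev fr X + s • fwd fr X d := by
  have hX := h.dev_eq (side_le X.1 d.1).1 (side_le X.1 d.1).2 (side_le X.2 d.2).1
    (side_le X.2 d.2).2
  rw [← Set.Ioi_insert, nhdsWithin_insert, Filter.eventually_sup]
  constructor
  · simp
  · filter_upwards [floor_add_eventually X.1 d.1, floor_add_eventually X.2 d.2] with s h1 h2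
    rw [dev_of_mem (X := X + s • d) h1 h2, hX, fwd, Frame.pt_add_vec]
    simp only [Prod.fst_add, Prod.snd_add, Prod.smul_fst, Prod.smul_snd, smul_eq_mul]
    congr 2 <;> ring_nf

theorem Good.cases {fr : ℤ → ℤ → Frame} {X : ℝ × ℝ} (h : Good fr X) :
    ∃ i j : ℤ, (X.1 = i ∨ (i : ℝ) < X.1 ∧ X.1 < i + 1) ∧ (X.2 = j ∨ (j : ℝ) < X.2 ∧ X.2 < j + 1) ∧
      ¬ (X.1 = i ∧ X.2 = j) ∧ (X.1 = i → fr i j = Frame.right (fr (i - 1) j)) ∧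
      (X.2 = j → fr i j = Frame.up (fr i (j - 1))) := by
  have fl : ∀ x : ℝ, x = ⌊x⌋ ∨ (⌊x⌋ : ℝ) < x ∧ x < ⌊x⌋ + 1 := fun x => by
    rcases (Int.floor_le x).eq_or_lt with h | h
    · exact Or.inl h.symm
    · exact Or.inr ⟨h, Int.lt_floor_add_one x⟩
  refine ⟨⌊X.1⌋, ⌊X.2⌋, fl _, fl _, ?_, fun h1 => ?_, fun h1 => ?_⟩
  · rintro ⟨h1, h2⟩
    obtain ⟨j, hj1, hj2, -⟩ := h.1 _ h1
    rw [h2] at hj1 hj2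
    have : j < ⌊X.2⌋ := by exact_mod_cast hj1
    have : ⌊X.2⌋ < j + 1 := by exact_mod_cast hj2
    omega
  · obtain ⟨j, hj1, hj2, hr⟩ := h.1 _ h1
    have : ⌊X.2⌋ = j := by rw [Int.floor_eq_iff]; exact ⟨hj1.le, hj2⟩
    rw [this]; exact hr
  · obtain ⟨i, hj1, hj2, hr⟩ := h.2 _ h1
    have : ⌊X.1⌋ = i := by rw [Int.floor_eq_iff]; exact ⟨hj1.le, hj2⟩
    rw [this]; exact hr

theorem side_intCast (i : ℤ) (p : ℝ) : side i p = if p < 0 then i - 1 else i := by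
  simp [side]

/-- The only doubtful case is that of directions on opposite sides of a lattice edge. There, a
direction strictly entering one face has a nonzero component normal to the other face. -/
theorem Good.fwd_inj {fr : ℤ → ℤ → Frame} {X : ℝ × ℝ} (h : Good fr X) {d d' : ℝ × ℝ}
    (he : fwd fr X d = fwd fr X d') : d = d' := by
  have fin : ∀ {F : Frame} {a b c a' b' c' : ℝ}, F.vec ![a, b, c] = F.vec ![a', b', c'] →
      a = a' ∧ b = b' ∧ c = c' := fun {F a b c a' b' c'} h => by
    have := F.vec_injective h
    exact ⟨congrFun this 0, congrFun this 1, congrFun this 2⟩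
  obtain ⟨i, j, hi, hj, hn, hr, hu⟩ := h.cases
  unfold fwd at he
  rcases hi with hi | hi
  · have hj := hj.resolve_left fun h => hn ⟨hi, h⟩
    rw [side_eq_of_mem hj.1 hj.2, side_eq_of_mem hj.1 hj.2, hi, side_intCast, side_intCast] at he
    split_ifs at he with h1 h2 h2
    · have := fin he; exact Prod.ext this.1 this.2.1
    · rw [hr hi, Frame.vec_right] at he
      have := fin he; exact absurd this.1 (by simpa using h1.ne)
    · rw [hr hi, Frame.vec_right] at he
      have := fin he; exact absurd this.1 (by simpa using h2.ne')
    · have := fin he; exact Prod.ext this.1 this.2.1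
  · rw [side_eq_of_mem hi.1 hi.2, side_eq_of_mem hi.1 hi.2] at he
    rcases hj with hj | hj
    · rw [hj, side_intCast, side_intCast] at he
      split_ifs at he with h1 h2 h2
      · have := fin he; exact Prod.ext this.1 this.2.1
      · rw [hu hj, Frame.vec_up] at he
        have := fin he; exact absurd this.2.1 (by simpa using h1.ne)
      · rw [hu hj, Frame.vec_up] at he
        have := fin he; exact absurd this.2.1 (by simpa using h2.ne')
      · have := fin he; exact Prod.ext this.1 this.2.1
    · rw [side_eq_of_mem hj.1 hj.2, side_eq_of_mem hj.1 hj.2] at he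
      have := fin he; exact Prod.ext this.1 this.2.1

/-- Inside a square this is the face rule, and on a lattice edge the rule for rolling over it.
Motion along the edge itself is the case `p = 0` or `q = 0` of the latter. -/
theorem Good.forced {L : ℝ} {γ : ℝ → Space} (hγ : IsSimpleClosedQuasigeodesic L γ)
    {fr : ℤ → ℤ → Frame} {X : ℝ × ℝ} (h : Good fr X) (d : ℝ × ℝ) {t : ℝ} (ht : γ t = dev fr X)
    (hu : Arrives γ t (fwd fr X (-d))) : Departs γ t (fwd fr X d) := by
  obtain ⟨i, j, hi, hj, hn, hr, hv⟩ := h.cases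
  have bd : ∀ {x : ℝ} {i : ℤ}, (i : ℝ) < x ∧ x < i + 1 → x - i ∈ Set.Ioo (0 : ℝ) 1 :=
    fun h => ⟨by linarith [h.1], by linarith [h.2]⟩
  unfold fwd at hu ⊢
  simp only [Prod.fst_neg, Prod.snd_neg] at hu
  rcases hi with hi | hi
  · have hj := hj.resolve_left fun h => hn ⟨hi, h⟩
    have hX := h.dev_eq (i := i - 1) (j := j) (by push_cast; linarith) (by push_cast; linarith)
      hj.1.le hj.2.le
    rw [hX, show X.1 - ((i - 1 : ℤ) : ℝ) = 1 by push_cast; linarith] at ht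
    rw [side_eq_of_mem hj.1 hj.2, hi, side_intCast] at hu ⊢
    simp only [Left.neg_neg_iff] at hu
    rcases lt_trichotomy d.1 0 with h1 | h1 | h1
    · rw [if_neg h1.not_gt, hr hi] at hu
      rw [if_pos h1]
      simpa using (hγ.departs_right _ (p := -d.1) (q := -d.2) (bd hj) ht (by linarith)).2 hu
    · rw [if_neg h1.not_gt, hr hi] at hu
      rw [if_neg h1.not_lt, hr hi]
      have h2 := (hγ.departs_right _ (p := 0) (q := d.2) (bd hj) ht le_rfl).1
      rw [h1] at hu ⊢
      refine h2 ?_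
      convert hu using 1
      rw [Frame.vec_right]; simp
    · rw [if_pos h1] at hu
      rw [if_neg h1.not_gt, hr hi]
      exact (hγ.departs_right _ (p := d.1) (q := d.2) (bd hj) ht h1.le).1 hu
  · rw [side_eq_of_mem hi.1 hi.2] at hu ⊢
    rcases hj with hj | hj
    · have hX := h.dev_eq (i := i) (j := j - 1) hi.1.le hi.2.le (by push_cast; linarith)
        (by push_cast; linarith)
      rw [hX, show X.2 - ((j - 1 : ℤ) : ℝ) = 1 by push_cast; linarith] at ht
      rw [hj, side_intCast] at hu ⊢
      simp only [Left.neg_neg_iff] at hu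
      rcases lt_trichotomy d.2 0 with h1 | h1 | h1
      · rw [if_neg h1.not_gt, hv hj] at hu
        rw [if_pos h1]
        simpa using (hγ.departs_up _ (p := -d.1) (q := -d.2) (bd hi) ht (by linarith)).2 hu
      · rw [if_neg h1.not_gt, hv hj] at hu
        rw [if_neg h1.not_lt, hv hj]
        have h2 := (hγ.departs_up _ (p := d.1) (q := 0) (bd hi) ht le_rfl).1
        rw [h1] at hu ⊢
        refine h2 ?_
        convert hu using 1
        rw [Frame.vec_up]; simp
      · rw [if_pos h1] at hu
        rw [if_neg h1.not_gt, hv hj]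
        exact (hγ.departs_up _ (p := d.1) (q := d.2) (bd hi) ht h1.le).1 hu
    · rw [side_eq_of_mem hj.1 hj.2] at hu ⊢
      rw [h.dev_eq hi.1.le hi.2.le hj.1.le hj.2.le] at ht
      exact hγ.departs_face _ (bd hi) (bd hj) ht hu

/-- At some time the curve passes the image of `X` in the direction `d`. -/
def Follows (γ : ℝ → Space) (fr : ℤ → ℤ → Frame) (X d : ℝ × ℝ) : Prop :=
  ∃ t w, γ t = dev fr X ∧ Departs γ t w ∧
    ∀ᶠ s in 𝓝[≥] (0 : ℝ), dev fr (X + s • d) = dev fr X + s • w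

variable {L : ℝ} {γ : ℝ → Space} {fr : ℤ → ℤ → Frame} {X d : ℝ × ℝ}

theorem Good.arrives (h : Good fr X) (hd : d.1 * d.1 + d.2 * d.2 = 1) (Y : ℝ × ℝ) {s : ℝ}
    (hX : X = Y + s • d) : Arrives (fun s => dev fr (Y + s • d)) s (fwd fr X (-d)) := by
  have hd' : (-d).1 * (-d).1 + (-d).2 * (-d).2 = 1 := by simpa using hd
  refine ⟨norm_fwd _ _ hd', (h.departs (-d)).mono fun r hr => ?_⟩
  show dev fr (Y + (s - r) • d) = dev fr (Y + s • d) + r • fwd fr X (-d)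
  rw [← hX, ← hr, hX]
  congr 1
  module

theorem Good.departs' (h : Good fr X) (hd : d.1 * d.1 + d.2 * d.2 = 1) (Y : ℝ × ℝ) {s : ℝ}
    (hX : X = Y + s • d) : Departs (fun s => dev fr (Y + s • d)) s (fwd fr X d) := by
  refine ⟨norm_fwd _ _ hd, (h.departs d).mono fun r hr => ?_⟩
  show dev fr (Y + (s + r) • d) = dev fr (Y + s • d) + r • fwd fr X d
  rw [← hX, ← hr, hX]
  congr 1
  module

theorem Follows.exists_eqOn (hγ : IsSimpleClosedQuasigeodesic L γ)
    (hd : d.1 * d.1 + d.2 * d.2 = 1) (h : Follows γ fr X d) {ℓ : ℝ}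
    (hG : ∀ s ∈ Set.Ioo 0 ℓ, Good fr (X + s • d)) :
    ∃ t, ∀ s ∈ Set.Ico 0 ℓ, γ (t + s) = dev fr (X + s • d) := by
  obtain ⟨t, w₀, h0, hw₀, hw₀'⟩ := h
  exact ⟨t, hγ.eqOn_of_forced (δ := fun s => dev fr (X + s • d)) (w₀ := w₀)
    (by simpa using h0) hw₀ ⟨hw₀.1, by simpa using hw₀'⟩
    (fun s hs => ⟨_, _, (hG s hs).arrives hd X rfl, (hG s hs).departs' hd X rfl,
      fun t' ht' => (hG s hs).forced hγ d ht'⟩)⟩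

/-- The curve arrives at the end of a segment of the unfolding that it follows. -/
theorem Follows.exists_arrives (hγ : IsSimpleClosedQuasigeodesic L γ)
    (hd : d.1 * d.1 + d.2 * d.2 = 1) (h : Follows γ fr X d) {ℓ : ℝ} (hℓ : 0 < ℓ)
    (hG : ∀ s ∈ Set.Ioo 0 ℓ, Good fr (X + s • d)) {P u : Space}
    (hP : ∀ᶠ r in 𝓝[>] (0 : ℝ), dev fr (X + (ℓ - r) • d) = P + r • u) :
    ∃ t, γ t = P ∧ Arrives γ t u := by
  obtain ⟨t, ht⟩ := h.exists_eqOn hγ hd hG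
  refine ⟨t + ℓ, hγ.arrives_of_eventually ?_⟩
  filter_upwards [hP, Ioo_mem_nhdsGT hℓ] with r hr hr'
  rw [← hr, add_sub_assoc]
  exact ht _ ⟨by linarith [hr'.2], by linarith [hr'.1]⟩

theorem Follows.trace (hγ : IsSimpleClosedQuasigeodesic L γ)
    (hd : d.1 * d.1 + d.2 * d.2 = 1) (h : Follows γ fr X d) {s : ℝ} (hs : 0 < s)
    (hG : ∀ r ∈ Set.Ioc 0 s, Good fr (X + r • d)) : Follows γ fr (X + s • d) d := by
  have hGs := hG s ⟨hs, le_rfl⟩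
  obtain ⟨t, ht, hu⟩ := h.exists_arrives hγ hd hs (fun r hr => hG r ⟨hr.1, hr.2.le⟩)
    (eventually_nhdsGT_of_nhdsGE (hGs.arrives hd X rfl).2)
  exact ⟨t, _, ht, hGs.forced hγ d ht hu, hGs.departs d⟩

theorem Follows.exists_departs (h : Follows γ fr X d) (hX : Good fr X) :
    ∃ t, γ t = dev fr X ∧ Departs γ t (fwd fr X d) := by
  obtain ⟨t, w, ht, hw, hw'⟩ := h
  obtain rfl : w = fwd fr X d := (eq_of_eventually_affine (eventually_nhdsGT_of_nhdsGE
    (hw'.mp ((hX.departs d).mono fun s h1 h2 => h2.symm.trans h1)))).2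
  exact ⟨t, ht, hw⟩

/-- The curve cannot pass a point in two directions. -/
theorem Follows.eq (hγ : IsSimpleClosedQuasigeodesic L γ) {d' : ℝ × ℝ} (hX : Good fr X)
    (h : Follows γ fr X d) (h' : Follows γ fr X d') : d = d' := by
  obtain ⟨t, ht, hw⟩ := h.exists_departs hX
  obtain ⟨t', ht', hv⟩ := h'.exists_departs hX
  exact hX.fwd_inj ((hγ.departs_of_eq (ht.trans ht'.symm) hw).unique hv)

theorem good_of_mem {i j : ℤ} (h1 : (i : ℝ) < X.1) (h2 : X.1 < i + 1) (h3 : (j : ℝ) < X.2)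
    (h4 : X.2 < j + 1) : Good fr X := by
  have key : ∀ {x : ℝ} {i k : ℤ}, (i : ℝ) < x → x < i + 1 → x ≠ k := by
    rintro x i k h1 h2 rfl
    have : i < k := by exact_mod_cast h1
    have : k < i + 1 := by exact_mod_cast h2
    omega
  exact ⟨fun k hk => absurd hk (key h1 h2), fun k hk => absurd hk (key h3 h4)⟩

/-- If two squares of the plane unfold the same face, turned by a right angle, then what the
curve follows in one of them it follows in the other. -/
theorem Follows.turn {Y w : ℝ × ℝ} {i j i' j' : ℤ} (h : Follows γ fr Y w)
    (h1 : (i : ℝ) < Y.1) (h2 : Y.1 < i + 1) (h3 : (j : ℝ) < Y.2) (h4 : Y.2 < j + 1)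
    (hfr : fr i' j' = (fr i j).turn) :
    Follows γ fr (i' + (1 - (Y.2 - j)), j' + (Y.1 - i)) (-w.2, w.1) := by
  obtain ⟨t, ht, hw⟩ := h.exists_departs (good_of_mem h1 h2 h3 h4)
  have hG : Good fr ((i' : ℝ) + (1 - (Y.2 - j)), (j' : ℝ) + (Y.1 - i)) :=
    good_of_mem (i := i') (j := j') (by simp only; linarith) (by simp only; linarith)
      (by simp only; linarith) (by simp only; linarith)
  refine ⟨t, _, ?_, hw, ?_⟩
  · rw [ht, (good_of_mem h1 h2 h3 h4).dev_eq h1.le h2.le h3.le h4.le,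
      hG.dev_eq (i := i') (j := j') (by simp only; linarith) (by simp only; linarith)
      (by simp only; linarith) (by simp only; linarith), hfr, Frame.pt_turn]
    simp
  · convert hG.departs (-w.2, w.1) using 5
    rw [fwd, fwd, side_eq_of_mem h1 h2, side_eq_of_mem h3 h4,
      side_eq_of_mem (i := i') (by simp only; linarith) (by simp only; linarith),
      side_eq_of_mem (i := j') (by simp only; linarith) (by simp only; linarith), hfr,
      Frame.vec_turn, neg_neg]

theorem eventually_mem_Ioo (x : ℝ) {p : ℝ} (hp : 0 < p) :
    ∀ᶠ s in 𝓝[>] (0 : ℝ), ∃ i : ℤ, (i : ℝ) < x + s * p ∧ x + s * p < i + 1 := by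
  filter_upwards [floor_add_eventually x p, self_mem_nhdsWithin] with s hs h0
  have h0 : 0 < s := h0
  refine ⟨⌊x⌋, ?_, ?_⟩
  · nlinarith [Int.floor_le x]
  · have := Int.lt_floor_add_one (x + s * p)
    rwa [hs, side, if_neg hp.not_gt] at this

end development

/-! ### Cylinders, and why a simple quasigeodesic cannot wind across one. -/

/-- An unfolding along a closed strip `0 < D₂ x - D₁ y < 1` of the plane, which covers a cylinder
on the cube with `m` vertices on each side. It extends to triangles beyond the vertices
`v + k D` of the strip, in which one can walk around a vertex on the outer side. -/
structure Cylinder where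
  D₁ : ℤ
  D₂ : ℤ
  v₁ : ℤ
  v₂ : ℤ
  m : ℤ
  fr : ℤ → ℤ → Frame
  D₁_nonneg : 0 ≤ D₁
  D₂_pos : 0 < D₂
  -- Together with the signs of `D₁` and `D₂`, this makes both plane coordinates positive for a
  -- direction with `0 < 3 * lam < mu`.
  D_le : D₁ ≤ 3 * D₂
  cross_v : D₂ * v₁ - D₁ * v₂ = 1
  -- A line from the origin that passes beyond `v` thereby has `3 * lam < mu`, which matches the
  -- factor `3` in the outer triangles.
  three_le : 3 ≤ D₁ * v₁ + D₂ * v₂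
  two_le_m : 2 ≤ m
  -- Hence `V k` with `k ≥ 1` lies at least one full turn `m D` along the strip from the origin.
  m_mul_le : (m - 1) * (D₁ * D₁ + D₂ * D₂) ≤ D₁ * v₁ + D₂ * v₂
  period : ∀ i j, fr (i + m * D₁) (j + m * D₂) = fr i j
  good_strip : ∀ x y : ℝ, 0 < D₂ * x - D₁ * y → D₂ * x - D₁ * y < 1 → Good fr (x, y)
  -- Relative to `V k`, the point is `b` back along `D` and `a` outward along `(D₂, -D₁)`. With `a =
  -- 0` allowed, the open side edge is included.
  good_left : ∀ (k : ℤ) (a b : ℝ), 0 ≤ a → 3 * a < b → 3 * a < 1 - b →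
    Good fr (v₁ + k * D₁ - b * D₁ + a * D₂, v₂ + k * D₂ - b * D₂ - a * D₁)
  good_right : ∀ (k : ℤ) (a b : ℝ), 0 < a → 0 ≤ b → 3 * a < 1 - b →
    Good fr (v₁ + k * D₁ + a * D₁ + b * D₂, v₂ + k * D₂ + a * D₂ - b * D₁)
  -- The quarter turn `(x, y) ↦ (-y, x)` about `V k` identifies the two outer quadrants, because
  -- only `π/2` of surface remains there. It sends the square `(i, j)` to `(-j - 1, i)`.
  glue : ∀ (k : ℤ) (a b : ℝ) (i j : ℤ), 0 < a → 3 * a < b → 3 * a < 1 - b →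
    (i : ℝ) < -b * D₁ + a * D₂ → -b * D₁ + a * D₂ < i + 1 →
    (j : ℝ) < -b * D₂ - a * D₁ → -b * D₂ - a * D₁ < j + 1 →
    fr (v₁ + k * D₁ - j - 1) (v₂ + k * D₂ + i) =
      (fr (v₁ + k * D₁ + i) (v₂ + k * D₂ + j)).turn
  -- The squares to the lower left, upper left and upper right of `V k` unfold the three faces at
  -- that vertex.
  corner_up : ∀ k : ℤ, fr (v₁ + k * D₁ - 1) (v₂ + k * D₂) =
    Frame.up (fr (v₁ + k * D₁ - 1) (v₂ + k * D₂ - 1))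
  corner_right : ∀ k : ℤ, fr (v₁ + k * D₁) (v₂ + k * D₂) =
    Frame.right (fr (v₁ + k * D₁ - 1) (v₂ + k * D₂))

namespace Cylinder

variable (C : Cylinder)

/-- The coordinate across the strip. -/
def lam (X : ℝ × ℝ) : ℝ := C.D₂ * X.1 - C.D₁ * X.2

/-- The coordinate along the strip. -/
def mu (X : ℝ × ℝ) : ℝ := C.D₁ * X.1 + C.D₂ * X.2

/-- The squared distance of consecutive vertices of the strip. -/
def N : ℝ := C.D₁ * C.D₁ + C.D₂ * C.D₂

/-- The vertices of the strip. -/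
def V (k : ℤ) : ℝ × ℝ := (C.v₁ + k * C.D₁, C.v₂ + k * C.D₂)

theorem D₂_pos' : (0 : ℝ) < C.D₂ := by exact_mod_cast C.D₂_pos

theorem D₁_nonneg' : (0 : ℝ) ≤ C.D₁ := by exact_mod_cast C.D₁_nonneg

theorem N_pos : 0 < C.N := by
  have := mul_pos C.D₂_pos' C.D₂_pos'
  have := mul_self_nonneg (C.D₁ : ℝ)
  unfold N; linarith

theorem lam_add (X Y : ℝ × ℝ) : C.lam (X + Y) = C.lam X + C.lam Y := by
  simp only [lam, Prod.fst_add, Prod.snd_add]; ring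

theorem mu_add (X Y : ℝ × ℝ) : C.mu (X + Y) = C.mu X + C.mu Y := by
  simp only [mu, Prod.fst_add, Prod.snd_add]; ring

theorem lam_smul (s : ℝ) (X : ℝ × ℝ) : C.lam (s • X) = s * C.lam X := by
  simp only [lam, Prod.smul_fst, Prod.smul_snd, smul_eq_mul]; ring

theorem mu_smul (s : ℝ) (X : ℝ × ℝ) : C.mu (s • X) = s * C.mu X := by
  simp only [mu, Prod.smul_fst, Prod.smul_snd, smul_eq_mul]; ring

theorem lam_V (k : ℤ) : C.lam (C.V k) = 1 := by
  have : (C.D₂ : ℝ) * C.v₁ - C.D₁ * C.v₂ = 1 := by exact_mod_cast C.cross_v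
  simp only [lam, V]; linarith

theorem mu_V (k : ℤ) : C.mu (C.V k) = C.mu (C.v₁, C.v₂) + k * C.N := by
  simp only [mu, V, N]; ring

theorem N_mul_fst (X : ℝ × ℝ) : C.N * X.1 = C.D₁ * C.mu X + C.D₂ * C.lam X := by
  simp only [N, mu, lam]; ring

theorem N_mul_snd (X : ℝ × ℝ) : C.N * X.2 = C.D₂ * C.mu X - C.D₁ * C.lam X := by
  simp only [N, mu, lam]; ring

variable {C} in
theorem ext_lam_mu {X Y : ℝ × ℝ} (h1 : C.lam X = C.lam Y) (h2 : C.mu X = C.mu Y) : X = Y := by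
  apply Prod.ext
  · have := C.N_mul_fst X
    rw [h1, h2, ← N_mul_fst] at this
    exact mul_left_cancel₀ C.N_pos.ne' this
  · have := C.N_mul_snd X
    rw [h1, h2, ← N_mul_snd] at this
    exact mul_left_cancel₀ C.N_pos.ne' this

theorem good_of_lam {X : ℝ × ℝ} (h0 : 0 < C.lam X) (h1 : C.lam X < 1) : Good C.fr X :=
  C.good_strip X.1 X.2 h0 h1

theorem good_of_left {X : ℝ × ℝ} (k : ℤ) {a b : ℝ} (ha : 0 ≤ a) (h : 3 * a < b)
    (h' : 3 * a < 1 - b) (h1 : C.lam X = 1 + a * C.N) (h2 : C.mu X = C.mu (C.V k) - b * C.N) :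
    Good C.fr X := by
  convert C.good_left k a b ha h h' using 1
  refine C.ext_lam_mu ?_ ?_
  · rw [h1, ← C.lam_V k]; simp only [lam, V, N]; ring
  · rw [h2]; simp only [mu, V, N]; ring

theorem good_of_right {X : ℝ × ℝ} (k : ℤ) {a b : ℝ} (ha : 0 < a) (hb : 0 ≤ b)
    (h' : 3 * a < 1 - b) (h1 : C.lam X = 1 + b * C.N) (h2 : C.mu X = C.mu (C.V k) + a * C.N) :
    Good C.fr X := by
  convert C.good_right k a b ha hb h' using 1
  refine C.ext_lam_mu ?_ ?_
  · rw [h1, ← C.lam_V k]; simp only [lam, V, N]; ring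
  · rw [h2]; simp only [mu, V, N]; ring

/-- The translation along the strip once around the cylinder. -/
def shift : ℝ × ℝ := (((C.m * C.D₁ : ℤ) : ℝ), ((C.m * C.D₂ : ℤ) : ℝ))

theorem dev_period (X : ℝ × ℝ) :
    dev C.fr (X + C.shift) = dev C.fr X := by
  simp only [dev, shift, Prod.fst_add, Prod.snd_add, Int.floor_add_intCast, Int.fract_add_intCast,
    C.period]

variable {L : ℝ} {γ : ℝ → Space} {d w : ℝ × ℝ}

theorem follows_period {X : ℝ × ℝ} (h : Follows γ C.fr X d) :
    Follows γ C.fr (X + C.shift) d := by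
  obtain ⟨t, w, ht, hw, hw'⟩ := h
  refine ⟨t, w, ht.trans (C.dev_period X).symm, hw, hw'.mono fun s hs => ?_⟩
  rw [add_right_comm, C.dev_period, C.dev_period, hs]

/-- Two lines that the curve follows cannot cross in the strip, up to the period of the strip. -/
theorem not_cross (hγ : IsSimpleClosedQuasigeodesic L γ) {X Y : ℝ × ℝ}
    (hX : Follows γ C.fr X d) (hY : Follows γ C.fr Y w) (h0 : 0 < C.lam X) (h1 : C.lam X < 1)
    (hl : C.lam X = C.lam Y) (hm : C.mu X + C.m * C.N = C.mu Y) : d = w := by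
  have hP : C.lam C.shift = 0 := by
    simp only [lam, shift]; push_cast; ring
  have hP' : C.mu C.shift = C.m * C.N := by
    simp only [mu, N, shift]; push_cast; ring
  have e : X + C.shift = Y := by
    refine C.ext_lam_mu ?_ ?_
    · rw [lam_add, hP, add_zero, hl]
    · rw [mu_add, hP', hm]
  have := C.follows_period hX
  rw [e] at this
  exact this.eq hγ (C.good_of_lam (by rwa [← hl]) (by rwa [← hl])) hY

/-- The curve crosses the strip from the origin in direction `d`, leaves it at time `T`, between
the vertices `V (k - 1)` and `V k`, and winds at least once around the cylinder before. -/
structure Crosses (γ : ℝ → Space) (d : ℝ × ℝ) (T : ℝ) (k : ℤ) (β : ℝ) : Prop where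
  lam_pos : 0 < C.lam d
  mu_gt : 3 * C.lam d < C.mu d
  T_mul : T * C.lam d = 1
  follows : ∀ s, 0 < s → s < T → Follows γ C.fr (s • d) d
  mu_T : T * C.mu d = C.mu (C.V k) - β * C.N
  winds : C.m * C.N ≤ C.mu (C.V k)
  β_le : β ≤ 1

variable {C} {T β : ℝ} {k : ℤ}

/-- The curve cannot walk around the vertex `V k` outside of the strip. -/
theorem Crosses.false_of_glue (H : C.Crosses γ d T k β) (hγ : IsSimpleClosedQuasigeodesic L γ)
    (hw : w.1 * w.1 + w.2 * w.2 = 1) (hw0 : 0 < C.lam w) (hw3 : 3 * C.lam w < C.mu w)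
    {Y : ℝ × ℝ} {a b : ℝ} (ha : 0 < a) (hab : 3 * a < b) (hab' : 3 * a < 1 - b)
    (hY1 : C.lam Y = 1 + a * C.N) (hY2 : C.mu Y = C.mu (C.V k) - b * C.N)
    {i j : ℤ} (h1 : (i : ℝ) < Y.1) (h2 : Y.1 < i + 1) (h3 : (j : ℝ) < Y.2) (h4 : Y.2 < j + 1)
    (hF : Follows γ C.fr Y w) : False := by
  have hN := C.N_pos
  have hY : Y = (C.v₁ + k * C.D₁ - b * C.D₁ + a * C.D₂, C.v₂ + k * C.D₂ - b * C.D₂ - a * C.D₁) := by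
    refine C.ext_lam_mu ?_ ?_
    · rw [hY1, ← C.lam_V k]; simp only [lam, V, N]; ring
    · rw [hY2]; simp only [mu, V, N]; ring
  have hg := C.glue k a b (i - (C.v₁ + k * C.D₁)) (j - (C.v₂ + k * C.D₂)) ha hab hab'
    (by push_cast; rw [hY] at h1; simp only at h1; linarith)
    (by push_cast; rw [hY] at h2; simp only at h2; linarith)
    (by push_cast; rw [hY] at h3; simp only at h3; linarith)
    (by push_cast; rw [hY] at h4; simp only at h4; linarith)
  rw [add_sub_cancel, add_sub_cancel] at hg
  have hF' := hF.turn h1 h2 h3 h4 hg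
  set Y' : ℝ × ℝ := _ with hY'
  set w' : ℝ × ℝ := (-w.2, w.1) with hw'
  change Follows γ C.fr Y' w' at hF'
  have hw'1 : w'.1 * w'.1 + w'.2 * w'.2 = 1 := by simp only [hw']; linarith
  have lY : C.lam Y' = 1 + b * C.N := by
    rw [← C.lam_V k, hY', hY]; simp only [lam, V, N]; push_cast; ring
  have mY : C.mu Y' = C.mu (C.V k) + a * C.N := by
    rw [hY', hY]; simp only [mu, V, N]; push_cast; ring
  have lw : C.lam w' = -C.mu w := by simp only [lam, mu, hw']; ring
  have mw : C.mu w' = C.lam w := by simp only [lam, mu, hw']; ring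
  have hl := H.lam_pos
  have hm := H.mu_gt
  have hmw : 0 < C.mu w := by linarith
  have hmd : 0 < C.mu d := by linarith
  have hm2 : (2 : ℝ) ≤ C.m := by exact_mod_cast C.two_le_m
  -- Cramer's rule for `(T - r) d + m D = Y' + t w'`, the crossing with the translated first pass;
  -- `r` is counted back from the exit and `Q` is the determinant.
  set Q := C.mu d * C.mu w + C.lam d * C.lam w with hQ
  have hQ0 : 0 < Q := by positivity
  set r := C.N * ((C.m - β - a) * C.mu w - b * C.lam w) / Q with hr
  have hrQ : r * Q = C.N * ((C.m - β - a) * C.mu w - b * C.lam w) := by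
    rw [hr]; field_simp
  have hr0 : 0 < r := by
    apply div_pos (mul_pos hN _) hQ0
    have : b * C.lam w ≤ 1 * C.lam w := by gcongr; linarith
    have : (1 / 3) * C.mu w < (C.m - β - a) * C.mu w := by
      gcongr; linarith [H.β_le]
    linarith
  set t := (b * C.N + r * C.lam d) / C.mu w with ht
  have htw : t * C.mu w = b * C.N + r * C.lam d := by rw [ht]; field_simp
  have ht0 : 0 < t := by
    have : 0 < b := by linarith
    positivity
  have htl : t * C.lam w = (C.m - β - a) * C.N - r * C.mu d := by
    apply mul_right_cancel₀ hmw.ne'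
    linear_combination C.lam w * htw + hrQ
  -- Here the winding is used: the translated pass starts no later than `V k` along the strip, so
  -- the crossing lies after its start.
  have hrT : r < T := by
    have e : r * C.mu d < T * C.mu d := by
      have := mul_pos ht0 hw0
      have := mul_pos ha hN
      have := H.winds
      rw [H.mu_T]; linarith
    exact lt_of_mul_lt_mul_right e hmd.le
  have hcr : Follows γ C.fr (Y' + t • w') w' := by
    refine hF'.trace hγ hw'1 ht0 fun τ hτ => ?_
    have hlam : C.lam (Y' + τ • w') = 1 + (b - τ * C.mu w / C.N) * C.N := by
      rw [lam_add, lam_smul, lY, lw]; field_simp; ring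
    have hmu : C.mu (Y' + τ • w') = C.mu (C.V k) + (a + τ * C.lam w / C.N) * C.N := by
      rw [mu_add, mu_smul, mY, mw]; field_simp; ring
    -- Until it reaches the side, the rotated line stays in the right outer triangle, since its
    -- slope is below `1/3`; afterwards it is in the strip.
    rcases le_or_gt 0 (b - τ * C.mu w / C.N) with hb | hb
    · have hτl : 0 < τ * C.lam w / C.N := div_pos (mul_pos hτ.1 hw0) hN
      refine C.good_of_right k (by linarith) hb ?_ hlam hmu
      have : 3 * (τ * C.lam w / C.N) < τ * C.mu w / C.N := by
        rw [← mul_div_assoc]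
        apply div_lt_div_of_pos_right _ hN
        have := mul_lt_mul_of_pos_left hw3 hτ.1
        linarith
      linarith
    · refine C.good_of_lam ?_ ?_
      · rw [lam_add, lam_smul, lY, lw]
        have : τ * C.mu w ≤ t * C.mu w := mul_le_mul_of_nonneg_right hτ.2 hmw.le
        have : r * C.lam d < T * C.lam d := mul_lt_mul_of_pos_right hrT hl
        have := H.T_mul
        linarith
      · rw [hlam]
        have := mul_neg_of_neg_of_pos hb hN
        linarith
  have hrl : r * C.lam d < T * C.lam d := mul_lt_mul_of_pos_right hrT hl
  have hTl := H.T_mul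
  have := C.not_cross hγ (H.follows (T - r) (by linarith) (by linarith)) hcr
    (by rw [lam_smul]; exact mul_pos (by linarith) hl)
    (by rw [lam_smul]; have := mul_pos hr0 hl; linarith)
    (by rw [lam_smul, lam_add, lam_smul, lY, lw]; linarith)
    (by rw [mu_smul, mu_add, mu_smul, mY, mw]; have := H.mu_T; linarith)
  rw [this, lw] at hl
  linarith

/-- The curve cannot leave the strip between `V (k - 1)` and `V k`. -/
theorem Crosses.false_of_left (H : C.Crosses γ d T k β) (hγ : IsSimpleClosedQuasigeodesic L γ)
    (hw : w.1 * w.1 + w.2 * w.2 = 1) (hw0 : 0 < C.lam w) (hw3 : 3 * C.lam w < C.mu w)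
    {X : ℝ × ℝ} {b : ℝ} (hb : 0 < b) (hb1 : b ≤ 1) (hX1 : C.lam X = 1)
    (hX2 : C.mu X = C.mu (C.V k) - b * C.N) (hF : Follows γ C.fr X w) : False := by
  have hN := C.N_pos
  have hmw : 0 < C.mu w := by linarith
  have hD1 := C.D₁_nonneg'
  have hD2 := C.D₂_pos'
  have hw1 : 0 < w.1 := by
    have := C.N_mul_fst w
    refine pos_of_mul_pos_right (this ▸ ?_ : 0 < C.N * w.1) hN.le
    have := mul_nonneg hD1 hmw.le
    have := mul_pos hD2 hw0
    linarith
  have hw2 : 0 < w.2 := by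
    have := C.N_mul_snd w
    refine pos_of_mul_pos_right (this ▸ ?_ : 0 < C.N * w.2) hN.le
    have hD : (C.D₁ : ℝ) ≤ 3 * C.D₂ := by exact_mod_cast C.D_le
    have := mul_le_mul_of_nonneg_right hD hw0.le
    have := mul_lt_mul_of_pos_left hw3 hD2
    linarith
  -- A step shorter than this keeps `3 a < b`. The bound `3 a < 1 - b` holds because `3 * lam w < mu
  -- w`, even when starting at the vertex `b = 1`. The step is also chosen to end off the lattice
  -- lines, as `glue` needs an open square.
  have hh : 0 < b * C.N / (3 * C.lam w + C.mu w) := by positivity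
  obtain ⟨h, ⟨⟨⟨i, hi1, hi2⟩, j, hj1, hj2⟩, hh2⟩, hh3⟩ := (((eventually_mem_Ioo X.1 hw1).and
    (eventually_mem_Ioo X.2 hw2)).and (Ioo_mem_nhdsGT hh)).and self_mem_nhdsWithin |>.exists
  have hh3 : 0 < h := hh3
  have key : ∀ r, 0 < r → r ≤ h → 0 < r * C.lam w / C.N ∧
      3 * (r * C.lam w / C.N) < b - r * C.mu w / C.N ∧
      3 * (r * C.lam w / C.N) < 1 - (b - r * C.mu w / C.N) ∧
      C.lam (X + r • w) = 1 + (r * C.lam w / C.N) * C.N ∧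
      C.mu (X + r • w) = C.mu (C.V k) - (b - r * C.mu w / C.N) * C.N := by
    intro r hr hrh
    refine ⟨by positivity, ?_, ?_, ?_, ?_⟩
    · have h1 := hrh.trans_lt hh2.2
      rw [lt_div_iff₀ (by positivity)] at h1
      rw [← sub_pos]
      have : b - r * C.mu w / C.N - 3 * (r * C.lam w / C.N) =
        (b * C.N - r * (3 * C.lam w + C.mu w)) / C.N := by field_simp; ring
      rw [this]
      exact div_pos (by linarith) hN
    · rw [← sub_pos]
      have : 1 - (b - r * C.mu w / C.N) - 3 * (r * C.lam w / C.N) =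
        (1 - b) + r * (C.mu w - 3 * C.lam w) / C.N := by field_simp; ring
      rw [this]
      have : 0 < r * (C.mu w - 3 * C.lam w) / C.N := div_pos (mul_pos hr (by linarith)) hN
      linarith
    · rw [lam_add, lam_smul, hX1]; field_simp
    · rw [mu_add, mu_smul, hX2]; field_simp; ring
  have hY := hF.trace hγ hw hh3 fun r hr => by
    obtain ⟨k1, k2, k3, k4, k5⟩ := key r hr.1 hr.2
    exact C.good_of_left k k1.le k2 k3 k4 k5
  obtain ⟨k1, k2, k3, k4, k5⟩ := key h hh3 le_rfl
  exact H.false_of_glue hγ hw hw0 hw3 k1 k2 k3 k4 k5 hi1 hi2 hj1 hj2 hY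

/-- The curve cannot enter the strip from a vertex of its outer side. -/
theorem Crosses.false_of_band (H : C.Crosses γ d T k β) (hγ : IsSimpleClosedQuasigeodesic L γ)
    (hβ : β = 0) (hw : w.1 * w.1 + w.2 * w.2 = 1) (hw0 : C.lam w < 0) (hw3 : 0 ≤ C.mu w) {q : ℤ}
    (hq : 0 ≤ q) (hqm : q < C.m) (hq0 : q = 0 → 0 < C.mu w) (hF : Follows γ C.fr (C.V (k + q)) w) :
    False := by
  have hN := C.N_pos
  have hl := H.lam_pos
  have hm := H.mu_gt
  have hmd : 0 < C.mu d := by linarith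
  have hq' : (0 : ℝ) ≤ q := by exact_mod_cast hq
  have hqm' : (q : ℝ) < C.m := by exact_mod_cast hqm
  have hV : C.mu (C.V (k + q)) = C.mu (C.V k) + q * C.N := by
    rw [mu_V, mu_V]; push_cast; ring
  -- Cramer's rule for `(T - r) d + m D = V (k + q) + t w`.
  set Q := C.mu d * -C.lam w + C.lam d * C.mu w with hQ
  have hw0' : 0 < -C.lam w := by linarith
  have hQ0 : 0 < Q := by
    have := mul_pos hmd hw0'
    have := mul_nonneg hl.le hw3
    linarith
  set r := (C.m - q) * C.N * -C.lam w / Q with hr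
  have hrQ : r * Q = (C.m - q) * C.N * -C.lam w := by
    rw [hr]; field_simp
  have hr0 : 0 < r := div_pos (mul_pos (mul_pos (by linarith) hN) hw0') hQ0
  set t := r * C.lam d / -C.lam w with ht
  have htw : t * -C.lam w = r * C.lam d := div_mul_cancel₀ _ hw0'.ne'
  have ht0 : 0 < t := div_pos (mul_pos hr0 hl) hw0'
  have htm : t * C.mu w = (C.m - q) * C.N - r * C.mu d := by
    apply mul_right_cancel₀ hw0'.ne'
    linear_combination C.mu w * htw + hrQ
  have hmT := H.mu_T
  have hTl := H.T_mul
  rw [hβ, zero_mul, sub_zero] at hmT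
  have hrT : r < T := by
    have e : r * C.mu d < T * C.mu d := by
      have := H.winds
      -- The strict inequality comes from `mu w > 0` if `q = 0`, and from the offset `q * N`
      -- otherwise.
      rcases hq.eq_or_lt with h | h
      · have := mul_pos ht0 (hq0 h.symm)
        have := mul_nonneg hq' hN.le
        rw [hmT]; linarith
      · have := mul_nonneg ht0.le hw3
        have : 0 < (q : ℝ) * C.N := mul_pos (by exact_mod_cast h) hN
        rw [hmT]; linarith
    exact lt_of_mul_lt_mul_right e hmd.le
  have hrl : r * C.lam d < T * C.lam d := mul_lt_mul_of_pos_right hrT hl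
  have hcr : Follows γ C.fr (C.V (k + q) + t • w) w := by
    refine hF.trace hγ hw ht0 fun τ hτ => C.good_of_lam ?_ ?_
    · rw [lam_add, lam_smul, lam_V]
      have := mul_le_mul_of_nonneg_right hτ.2 hw0'.le
      linarith
    · rw [lam_add, lam_smul, lam_V]
      have := mul_pos hτ.1 hw0'
      linarith
  have := C.not_cross hγ (H.follows (T - r) (by linarith) (by linarith)) hcr
    (by rw [lam_smul]; exact mul_pos (by linarith) hl)
    (by rw [lam_smul]; have := mul_pos hr0 hl; linarith)
    (by rw [lam_smul, lam_add, lam_smul, lam_V]; linarith)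
    (by rw [mu_smul, mu_add, mu_smul, hV]; linarith)
  rw [this] at hl
  linarith

variable (C)

/-- The frame of the square to the lower left of the vertex `V k`. -/
def cornerFrame (k : ℤ) : Frame := C.fr (C.v₁ + k * C.D₁ - 1) (C.v₂ + k * C.D₂ - 1)

/-- The curve reaches the vertex `V k` from the lower left in direction `d`. -/
def ArrivesAt (γ : ℝ → Space) (k : ℤ) (d : ℝ × ℝ) : Prop :=
  ∃ t, γ t = (C.cornerFrame k).pt ![1, 1, 0] ∧
    Arrives γ t ((C.cornerFrame k).vec ![-d.1, -d.2, 0])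

variable {C}

theorem arrivesAt_of_follows (hγ : IsSimpleClosedQuasigeodesic L γ) {X : ℝ × ℝ}
    (hd : d.1 * d.1 + d.2 * d.2 = 1) (hd1 : 0 ≤ d.1) (hd2 : 0 ≤ d.2) {s : ℝ} (hs : 0 < s)
    (hF : Follows γ C.fr X d) (hG : ∀ r ∈ Set.Ioo 0 s, Good C.fr (X + r • d))
    (hV : X + s • d = C.V k) : C.ArrivesAt γ k d := by
  have d1 : d.1 ≤ 1 := by nlinarith
  have d2 : d.2 ≤ 1 := by nlinarith
  refine hF.exists_arrives hγ hd hs hG ?_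
  filter_upwards [Ioo_mem_nhdsGT (lt_min hs one_pos)] with r hr
  have hr1 : r < s := hr.2.trans_le (min_le_left _ _)
  have hr2 : r < 1 := hr.2.trans_le (min_le_right _ _)
  have hr0 := hr.1
  have e : X + (s - r) • d = C.V k - r • d := by rw [← hV]; module
  have e1 : (C.V k - r • d).1 = C.v₁ + k * C.D₁ - r * d.1 := by simp [V]
  have e2 : (C.V k - r • d).2 = C.v₂ + k * C.D₂ - r * d.2 := by simp [V]
  have hg := hG (s - r) ⟨by linarith, by linarith⟩
  have m1 := mul_nonneg hr0.le hd1
  have m2 := mul_nonneg hr0.le hd2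
  have m3 : r * d.1 ≤ 1 := mul_le_one₀ hr2.le hd1 d1
  have m4 : r * d.2 ≤ 1 := mul_le_one₀ hr2.le hd2 d2
  rw [e] at hg ⊢
  rw [hg.dev_eq (i := C.v₁ + k * C.D₁ - 1) (j := C.v₂ + k * C.D₂ - 1)
    (by rw [e1]; push_cast; linarith) (by rw [e1]; push_cast; linarith)
    (by rw [e2]; push_cast; linarith) (by rw [e2]; push_cast; linarith), cornerFrame,
    Frame.pt_add_vec, e1, e2]
  congr 1
  push_cast
  ring_nf

/-- At a vertex the curve turns to the left by at most a right angle, or goes straight on. -/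
theorem ArrivesAt.exists_follows (hγ : IsSimpleClosedQuasigeodesic L γ) (h : C.ArrivesAt γ k d)
    (hd1 : 0 ≤ d.1) (hd2 : 0 < d.2) :
    ∃ w : ℝ × ℝ, w.1 * w.1 + w.2 * w.2 = 1 ∧ 0 ≤ d.1 * w.1 + d.2 * w.2 ∧
      0 ≤ d.1 * w.2 - d.2 * w.1 ∧ Follows γ C.fr (C.V k) w := by
  obtain ⟨t, ht, hu⟩ := h
  set F₀ := C.cornerFrame k with hF₀
  set F₁ := C.fr (C.v₁ + k * C.D₁ - 1) (C.v₂ + k * C.D₂) with hF₁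
  set F := C.fr (C.v₁ + k * C.D₁) (C.v₂ + k * C.D₂) with hF
  have h1 : F₁ = Frame.up F₀ := C.corner_up k
  have h2 : F = Frame.right F₁ := C.corner_right k
  -- In the upper right frame `F`, the lower left square is the face `y = 0` and the upper left one
  -- is `x = 0`, which is the setting of `departs_vertex`.
  have hpt : F₀.pt ![1, 1, 0] = F.pt ![0, 0, 0] := by
    rw [h2, h1, Frame.pt_right, Frame.pt_up]; simp
  have hvec : F₀.vec ![-d.1, -d.2, 0] = F.vec ![d.2, 0, d.1] := by
    rw [h2, h1, Frame.vec_right, Frame.vec_up]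
  have hdev : dev C.fr (C.V k) = F.pt ![0, 0, 0] := by
    have f1 : ⌊(C.V k).1⌋ = C.v₁ + k * C.D₁ := by
      rw [Int.floor_eq_iff]; simp only [V]; push_cast; constructor <;> linarith
    have f2 : ⌊(C.V k).2⌋ = C.v₂ + k * C.D₂ := by
      rw [Int.floor_eq_iff]; simp only [V]; push_cast; constructor <;> linarith
    rw [dev_of_mem f1 f2]
    simp [V, ← hF]
  rw [hpt] at ht
  rw [hvec] at hu
  have near : ∀ᶠ s in 𝓝[≥] (0 : ℝ), s ∈ Set.Ico (0 : ℝ) 1 := Ico_mem_nhdsGE one_pos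
  obtain ⟨p, q, hp, hq, hpq, hw⟩ := hγ.departs_vertex F ht hd2 hd1 hu
  have north : ∀ w : ℝ × ℝ, w.1 * w.1 + w.2 * w.2 = 1 → 0 ≤ w.1 → 0 ≤ w.2 →
      Departs γ t (F.vec ![w.1, w.2, 0]) → Follows γ C.fr (C.V k) w := by
    intro w hw1 w1 w2 hw
    refine ⟨t, _, ht.trans hdev.symm, hw, ?_⟩
    have d1 : w.1 ≤ 1 := by nlinarith
    have d2 : w.2 ≤ 1 := by nlinarith
    filter_upwards [near] with s hs
    have m1 := mul_nonneg hs.1 w1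
    have m2 := mul_nonneg hs.1 w2
    have m3 : s * w.1 < 1 := (mul_le_of_le_one_right hs.1 d1).trans_lt hs.2
    have m4 : s * w.2 < 1 := (mul_le_of_le_one_right hs.1 d2).trans_lt hs.2
    have f1 : ⌊(C.V k + s • w).1⌋ = C.v₁ + k * C.D₁ := by
      rw [Int.floor_eq_iff]
      simp only [V, Prod.fst_add, Prod.smul_fst, smul_eq_mul]
      push_cast; constructor <;> linarith
    have f2 : ⌊(C.V k + s • w).2⌋ = C.v₂ + k * C.D₂ := by
      rw [Int.floor_eq_iff]
      simp only [V, Prod.snd_add, Prod.smul_snd, smul_eq_mul]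
      push_cast; constructor <;> linarith
    rw [dev_of_mem f1 f2, hdev, Frame.pt_add_vec, ← hF]
    simp [V]
  rcases hw with ⟨hle, hw⟩ | ⟨hle, hw⟩
  · refine ⟨(-p, q), by simp only; linarith, by simp only; linarith,
      by simp only; nlinarith, ?_⟩
    -- The vertical direction lies on the common edge, which the floor assigns to the upper right
    -- square.
    rcases hp.eq_or_lt with h0 | h0
    · refine north _ (by simp only; linarith) (by simp [← h0]) hq ?_
      simpa [← h0] using hw
    · refine ⟨t, _, ht.trans hdev.symm, hw, ?_⟩
      have d1 : p ≤ 1 := by nlinarith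
      have d2 : q ≤ 1 := by nlinarith
      rw [← Set.Ioi_insert, nhdsWithin_insert, Filter.eventually_sup]
      refine ⟨by simp only [Filter.eventually_pure, zero_smul, add_zero], ?_⟩
      filter_upwards [Ioo_mem_nhdsGT one_pos] with s hs
      have m1 := mul_pos hs.1 h0
      have m2 := mul_nonneg hs.1.le hq
      have m3 : s * p < 1 := (mul_le_of_le_one_right hs.1.le d1).trans_lt hs.2
      have m4 : s * q < 1 := (mul_le_of_le_one_right hs.1.le d2).trans_lt hs.2
      have f1 : ⌊(C.V k + s • ((-p, q) : ℝ × ℝ)).1⌋ = C.v₁ + k * C.D₁ - 1 := by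
        rw [Int.floor_eq_iff]
        simp only [V, Prod.fst_add, Prod.smul_fst, smul_eq_mul]
        push_cast; constructor <;> linarith
      have f2 : ⌊(C.V k + s • ((-p, q) : ℝ × ℝ)).2⌋ = C.v₂ + k * C.D₂ := by
        rw [Int.floor_eq_iff]
        simp only [V, Prod.snd_add, Prod.smul_snd, smul_eq_mul]
        push_cast; constructor <;> linarith
      have e3 : F.vec ![0, q, p] = F₁.vec ![-p, q, 0] := by rw [h2, Frame.vec_right]
      have e4 : F.pt ![0, 0, 0] = F₁.pt ![1, 0, 0] := by rw [h2, Frame.pt_right, sub_zero]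
      rw [dev_of_mem f1 f2, hdev, e3, e4, Frame.pt_add_vec, ← hF₁]
      congr 1
      simp only [V, Prod.fst_add, Prod.snd_add, Prod.smul_fst, Prod.smul_snd, smul_eq_mul]
      push_cast
      ring_nf
  · exact ⟨(q, p), by simp only; linarith, by simp only; positivity, by simp only; linarith,
      north _ (by simp only; linarith) hq hp hw⟩

variable (C)

/-- The unit vector along the strip. -/
def e : ℝ × ℝ := (C.D₁ / √C.N, C.D₂ / √C.N)

theorem sqrt_N_pos : 0 < √C.N := Real.sqrt_pos.2 C.N_pos

theorem e_unit : C.e.1 * C.e.1 + C.e.2 * C.e.2 = 1 := by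
  have h := Real.mul_self_sqrt C.N_pos.le
  have := C.sqrt_N_pos
  simp only [e]
  field_simp
  rw [sq √C.N, h, N]; ring

theorem lam_e : C.lam C.e = 0 := by simp only [lam, e]; ring

theorem mu_e : C.mu C.e = √C.N := by
  have h := Real.mul_self_sqrt C.N_pos.le
  have := C.sqrt_N_pos
  simp only [mu, e]
  field_simp
  rw [sq √C.N, h, N]; ring

variable {C}

theorem unit_lam_mu (w : ℝ × ℝ) (hw : w.1 * w.1 + w.2 * w.2 = 1) :
    C.lam w * C.lam w + C.mu w * C.mu w = C.N := by
  have : C.lam w * C.lam w + C.mu w * C.mu w = C.N * (w.1 * w.1 + w.2 * w.2) := by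
    simp only [lam, mu, N]; ring
  rw [this, hw, mul_one]

theorem eq_e (hw : w.1 * w.1 + w.2 * w.2 = 1) (hl : C.lam w = 0) (hm : 0 ≤ C.mu w) : w = C.e := by
  refine C.ext_lam_mu (by rw [hl, lam_e]) ?_
  have := unit_lam_mu (C := C) w hw
  rw [hl, mul_zero, zero_add] at this
  rw [mu_e, ← this, Real.sqrt_mul_self hm]

theorem good_edge (k : ℤ) {s : ℝ} (hs : s ∈ Set.Ioo 0 √C.N) : Good C.fr (C.V k + s • C.e) := by
  have hN := C.N_pos
  have hs' := C.sqrt_N_pos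
  have h := Real.mul_self_sqrt C.N_pos.le
  refine C.good_of_left (k + 1) (a := 0) (b := 1 - s / √C.N) le_rfl ?_ ?_ ?_ ?_
  · have : s / √C.N < 1 := (div_lt_one hs').2 hs.2
    linarith
  · have : 0 < s / √C.N := div_pos hs.1 hs'
    linarith
  · rw [lam_add, lam_smul, lam_e, lam_V]; ring
  · rw [mu_add, mu_smul, mu_e, mu_V, mu_V]
    have : s / √C.N * C.N = s * √C.N := by
      rw [div_mul_eq_mul_div, div_eq_iff hs'.ne', mul_assoc, h]
    push_cast
    linarith

theorem arrivesAt_succ (hγ : IsSimpleClosedQuasigeodesic L γ) (h : Follows γ C.fr (C.V k) C.e) :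
    C.ArrivesAt γ (k + 1) C.e := by
  have hs' := C.sqrt_N_pos
  refine arrivesAt_of_follows hγ C.e_unit (div_nonneg C.D₁_nonneg' hs'.le)
    (div_nonneg C.D₂_pos'.le hs'.le) hs' h (fun r hr => good_edge k hr) ?_
  refine C.ext_lam_mu ?_ ?_
  · rw [lam_add, lam_smul, lam_e, lam_V, lam_V]; ring
  · rw [mu_add, mu_smul, mu_e, mu_V, mu_V, Real.mul_self_sqrt C.N_pos.le]; push_cast; ring

/-- The curve cannot cross the strip from vertex to vertex. -/
theorem Crosses.false_of_vertex (H : C.Crosses γ d T k β) (hγ : IsSimpleClosedQuasigeodesic L γ)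
    (hβ : β = 0) (hd1 : 0 ≤ d.1) (hd2 : 0 < d.2) (hA : C.ArrivesAt γ k d) : False := by
  have hN := C.N_pos
  have hl := H.lam_pos
  have hm := H.mu_gt
  have hmd : 0 < C.mu d := by linarith
  have dot : ∀ d w : ℝ × ℝ, C.N * (d.1 * w.1 + d.2 * w.2) =
      C.mu d * C.mu w + C.lam d * C.lam w := fun d w => by simp only [N, mu, lam]; ring
  have cross : ∀ d w : ℝ × ℝ, C.N * (d.1 * w.2 - d.2 * w.1) =
      C.lam d * C.mu w - C.mu d * C.lam w := fun d w => by simp only [N, mu, lam]; ring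
  have step0 : C.ArrivesAt γ (k + 1) C.e := by
    obtain ⟨w, hw, hdot, hcr, hF⟩ := hA.exists_follows hγ hd1 hd2
    have hdot := dot d w ▸ mul_nonneg hN.le hdot
    have hcr := cross d w ▸ mul_nonneg hN.le hcr
    rcases lt_trichotomy (C.lam w) 0 with h | h | h
    · refine (H.false_of_band hγ hβ hw h ?_ (q := 0) le_rfl (by have := C.two_le_m; omega)
        (fun _ => ?_) (by simpa using hF)).elim
      all_goals
        have := mul_neg_of_pos_of_neg hl h
        have : 0 < C.mu d * C.mu w := by linarith
        have := pos_of_mul_pos_right this hmd.le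
        linarith
    · rw [h, mul_zero, add_zero] at hdot
      rw [eq_e hw h (nonneg_of_mul_nonneg_right hdot hmd)] at hF
      exact arrivesAt_succ hγ hF
    · have h3 : 3 * C.lam w < C.mu w := by
        have : C.lam d * (3 * C.lam w) < C.lam d * C.mu w := by
          have := mul_lt_mul_of_pos_right hm h
          linarith
        exact lt_of_mul_lt_mul_left this hl.le
      -- The exit at `V k` is regarded as the lower end `β = 1` of the side from `V k` to `V (k +
      -- 1)`, so the flat exit is excluded by the quarter turn about `V (k + 1)`.
      have H' : C.Crosses γ d T (k + 1) 1 :=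
        { H with
          mu_T := by rw [H.mu_T, hβ, mu_V, mu_V]; push_cast; ring
          winds := by
            refine H.winds.trans ?_
            rw [mu_V, mu_V]; push_cast; linarith
          β_le := le_rfl }
      refine (H'.false_of_left hγ hw h h3 (b := 1) one_pos le_rfl (C.lam_V k) ?_ hF).elim
      rw [mu_V, mu_V]; push_cast; ring
  -- Arriving along the side and turning left, the curve either enters the strip, which is excluded,
  -- or runs on to the next vertex.
  have step : ∀ q : ℕ, (q : ℤ) + 1 ≤ C.m → C.ArrivesAt γ (k + (q + 1)) C.e := by
    intro q
    induction q with
    | zero => intro _; simpa using step0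
    | succ q ih =>
      intro hq
      push_cast at hq ⊢
      have he2 : 0 < C.e.2 := div_pos C.D₂_pos' C.sqrt_N_pos
      obtain ⟨w, hw, hdot, hcr, hF⟩ := (ih (by omega)).exists_follows hγ
        (div_nonneg C.D₁_nonneg' C.sqrt_N_pos.le) he2
      have hdot := dot C.e w ▸ mul_nonneg hN.le hdot
      have hcr := cross C.e w ▸ mul_nonneg hN.le hcr
      rw [lam_e, mu_e, zero_mul] at hdot hcr
      have hmw : 0 ≤ C.mu w := nonneg_of_mul_nonneg_right (by linarith) C.sqrt_N_pos
      have hlw : C.lam w ≤ 0 := by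
        have := nonneg_of_mul_nonneg_right
          (by linarith : 0 ≤ √C.N * -C.lam w) C.sqrt_N_pos
        linarith
      rcases hlw.lt_or_eq with h | h
      · exact (H.false_of_band hγ hβ hw h hmw (q := q + 1) (by omega) (by omega)
          (fun h => by omega) hF).elim
      · rw [eq_e hw h hmw] at hF
        have := arrivesAt_succ hγ hF
        rwa [add_assoc] at this
  obtain ⟨n, hn⟩ := Int.eq_ofNat_of_zero_le (by have := C.two_le_m; omega : 0 ≤ C.m - 1)
  have hend := step n (by omega)
  rw [← hn, sub_add_cancel] at hend
  -- After `m` vertices the curve is back at the same cube vertex, arriving along `e` instead of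
  -- `d`.
  have hcf : C.cornerFrame (k + C.m) = C.cornerFrame k := by
    rw [cornerFrame, cornerFrame, ← C.period (C.v₁ + k * C.D₁ - 1)]
    congr 1 <;> ring
  obtain ⟨t, ht, hu⟩ := hA
  obtain ⟨t', ht', hu'⟩ := hend
  rw [hcf] at ht' hu'
  have hv := Frame.vec_injective _ ((hγ.arrives_of_eq (ht.trans ht'.symm) hu).unique hu')
  have h1 : -d.1 = -C.e.1 := congrFun hv 0
  have h2 : -d.2 = -C.e.2 := congrFun hv 1
  have : d = C.e := Prod.ext (neg_injective h1) (neg_injective h2)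
  rw [this, lam_e] at hl
  exact lt_irrefl _ hl

/-- No simple closed quasigeodesic crosses a cylinder, winding around it. -/
theorem not_follows (C : Cylinder) (hγ : IsSimpleClosedQuasigeodesic L γ)
    (hd : d.1 * d.1 + d.2 * d.2 = 1) (hd1 : 0 < d.1) (hd2 : 0 < d.2) (hl : 0 < C.lam d)
    (hm : C.mu (C.v₁, C.v₂) * C.lam d < C.mu d) : ¬ Follows γ C.fr (0, 0) d := by
  intro hF
  have hN := C.N_pos
  have h3 : (3 : ℝ) ≤ C.mu (C.v₁, C.v₂) := by
    have := C.three_le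
    simp only [mu]; exact_mod_cast this
  have hmN : (C.m - 1) * C.N ≤ C.mu (C.v₁, C.v₂) := by
    have := C.m_mul_le
    simp only [mu, N]; exact_mod_cast this
  have hm3 : 3 * C.lam d < C.mu d := by
    have := mul_le_mul_of_nonneg_right h3 hl.le
    linarith
  set T := 1 / C.lam d with hT
  have hT0 : 0 < T := by positivity
  have hTl : T * C.lam d = 1 := by rw [hT]; field_simp
  have hTm : C.mu (C.v₁, C.v₂) < T * C.mu d := by
    rw [hT, one_div, inv_mul_eq_div, lt_div_iff₀ hl]; exact hm
  set k := ⌈(T * C.mu d - C.mu (C.v₁, C.v₂)) / C.N⌉ with hk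
  have hk1 : (T * C.mu d - C.mu (C.v₁, C.v₂)) ≤ k * C.N := by
    rw [← div_le_iff₀ hN]; exact Int.le_ceil _
  have hk2 : (k : ℝ) * C.N < (T * C.mu d - C.mu (C.v₁, C.v₂)) + C.N := by
    have := Int.ceil_lt_add_one ((T * C.mu d - C.mu (C.v₁, C.v₂)) / C.N)
    rw [← hk, ← sub_lt_iff_lt_add, lt_div_iff₀ hN] at this
    linarith
  have hk0 : (1 : ℝ) ≤ k := by
    have : 0 < k := Int.ceil_pos.2 (div_pos (by linarith) hN)
    exact_mod_cast this
  have hwinds : C.m * C.N ≤ C.mu (C.V k) := by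
    rw [mu_V]
    have := mul_le_mul_of_nonneg_right hk0 hN.le
    linarith
  have helix : ∀ s, 0 < s → s < T → Follows γ C.fr (s • d) d := by
    intro s hs hsT
    have := hF.trace hγ hd hs fun r hr => C.good_of_lam (by
      rw [lam_add, lam_smul]; have := mul_pos hr.1 hl; simp only [lam] at this ⊢; linarith) (by
      have := mul_lt_mul_of_pos_right (hr.2.trans_lt hsT) hl
      rw [lam_add, lam_smul]; simp only [lam] at this hTl ⊢; linarith)
    rwa [show ((0, 0) : ℝ × ℝ) + s • d = s • d from zero_add _] at this
  have hG : ∀ r ∈ Set.Ioo 0 T, Good C.fr ((0, 0) + r • d) := fun r hr => C.good_of_lam (by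
      rw [lam_add, lam_smul]; have := mul_pos hr.1 hl; simp only [lam] at this ⊢; linarith) (by
      have := mul_lt_mul_of_pos_right hr.2 hl
      rw [lam_add, lam_smul]; simp only [lam] at this hTl ⊢; linarith)
  have hlT : C.lam ((0, 0) + T • d) = 1 := by
    rw [lam_add, lam_smul, hTl]; simp [lam]
  have hmT : C.mu ((0, 0) + T • d) = T * C.mu d := by
    rw [mu_add, mu_smul]; simp [mu]
  set β := (C.mu (C.V k) - T * C.mu d) / C.N with hβ
  have hβN : β * C.N = C.mu (C.V k) - T * C.mu d := by rw [hβ]; field_simp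
  have hβ1 : β < 1 := by rw [hβ, div_lt_one hN, mu_V]; linarith
  have hβ0 : 0 ≤ β := by apply div_nonneg _ hN.le; rw [mu_V]; linarith
  have H : C.Crosses γ d T k β := ⟨hl, hm3, hTl, helix, by linarith, hwinds, hβ1.le⟩
  rcases hβ0.eq_or_lt with h0 | h0
  · refine H.false_of_vertex hγ h0.symm hd1.le hd2
      (arrivesAt_of_follows hγ hd hd1.le hd2.le hT0 hF hG ?_)
    refine C.ext_lam_mu (by rw [hlT, lam_V]) ?_
    rw [hmT]; rw [← h0, zero_mul] at hβN; linarith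
  · refine H.false_of_left hγ hd hl hm3 h0 hβ1.le hlT (by rw [hmT]; linarith)
      (hF.trace hγ hd hT0 fun r hr => ?_)
    rcases hr.2.eq_or_lt with h | h
    · rw [h]
      exact C.good_of_left k (a := 0) (b := β) le_rfl (by linarith) (by linarith)
        (by rw [hlT]; ring) (by rw [hmT]; linarith)
    · exact hG r ⟨hr.1, h⟩

end Cylinder

/-! ### The four cylinders on the cube. -/

section instances

open CubeQuasigeodesic.Frame

/-- The unfolding of the cylinder whose sides are squares of edges of the cube. -/
def squareFrames (F : Frame) (i j : ℤ) : Frame := ((if i = 1 then right else 1) * up ^ j) F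

theorem squareFrames_right (F : Frame) {i j : ℤ} (h : i = 1) :
    squareFrames F i j = right (squareFrames F (i - 1) j) := by
  subst h; simp [squareFrames]

theorem squareFrames_up (F : Frame) {i j : ℤ} (h : i = 0) :
    squareFrames F i j = up (squareFrames F i (j - 1)) := by
  subst h
  simp only [squareFrames, zero_ne_one, if_false, one_mul, ← Equiv.Perm.mul_apply,
    ← zpow_one_add, add_sub_cancel]

/-- The cylinder unfolded by `squareFrames`. -/
def squareCylinder (F : Frame) : Cylinder where
  D₁ := 0
  D₂ := 1
  v₁ := 1
  v₂ := 3
  m := 4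
  fr := squareFrames F
  D₁_nonneg := le_rfl
  D₂_pos := one_pos
  D_le := by norm_num
  cross_v := by norm_num
  three_le := by norm_num
  two_le_m := by norm_num
  m_mul_le := by norm_num
  period i j := by
    have : (up : Equiv.Perm Frame) ^ (4 : ℤ) = 1 := Equiv.ext (by decide)
    simp [squareFrames, zpow_add, this]
  good_strip x y h0 h1 := by
    push_cast at h0 h1
    constructor <;> intro i hi <;> simp only at hi
    · exfalso
      have : 0 < i := by exact_mod_cast (by linarith : (0 : ℝ) < i)
      have : i < 1 := by exact_mod_cast (by linarith : (i : ℝ) < 1)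
      omega
    · exact ⟨0, by push_cast; linarith, by push_cast; linarith, squareFrames_up F rfl⟩
  good_left k a b ha h h' := by
    constructor <;> intro i hi <;> push_cast at hi ⊢
    · have : i < 2 := by exact_mod_cast (by linarith : (i : ℝ) < 2)
      have : 0 < i := by exact_mod_cast (by linarith : (0 : ℝ) < i)
      exact ⟨3 + k - 1, by push_cast; linarith, by push_cast; linarith,
        squareFrames_right F (by omega)⟩
    · exfalso
      have : i < 3 + k := by exact_mod_cast (by linarith : (i : ℝ) < 3 + k)
      have : 3 + k - 1 < i := by exact_mod_cast (by linarith : (3 + k - 1 : ℝ) < i)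
      omega
  good_right k a b ha h h' := by
    constructor <;> intro i hi <;> push_cast at hi ⊢
    · have : i < 2 := by exact_mod_cast (by linarith : (i : ℝ) < 2)
      have : 0 < i := by exact_mod_cast (by linarith : (0 : ℝ) < i)
      exact ⟨3 + k, by push_cast; linarith, by push_cast; linarith,
        squareFrames_right F (by omega)⟩
    · exfalso
      have : i < 3 + k + 1 := by exact_mod_cast (by linarith : (i : ℝ) < 3 + k + 1)
      have : 3 + k < i := by exact_mod_cast (by linarith : (3 + k : ℝ) < i)
      omega
  glue k a b i j ha h h' h1 h2 h3 h4 := by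
    push_cast at h1 h2 h3 h4
    have : -1 < i := by exact_mod_cast (by linarith : (-1 : ℝ) < i)
    have : i < 1 := by exact_mod_cast (by linarith : (i : ℝ) < 1)
    have : -2 < j := by exact_mod_cast (by linarith : (-2 : ℝ) < j)
    have : j < 0 := by exact_mod_cast (by linarith : (j : ℝ) < 0)
    obtain rfl : i = 0 := by omega
    obtain rfl : j = -1 := by omega
    -- All squares of the outer column unfold one face, each turned by a right angle against the
    -- next.
    have key : ∀ x : Frame, right (up x) = (right x).turn := by decide
    have := key ((up ^ (3 + k - 1)) F)
    simp only [← Equiv.Perm.mul_apply, ← zpow_one_add, add_sub_cancel] at this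
    simpa [squareFrames, sub_eq_add_neg] using this
  corner_up k := squareFrames_up F (by ring)
  corner_right k := squareFrames_right F (by ring)

/-- The unfolding of the cylinder whose sides are triangles of face diagonals. -/
def triangleFrames (F : Frame) (i j : ℤ) : Frame :=
  -- The class `i - j` is constant along `D`, and `up * right` advances by `D`. Class `2` is forced
  -- by rolling back from the strip; the default is meant for class `0` and is irrelevant for
  -- squares never visited.
  ((if i - j = 1 then right else if i - j = 2 then up⁻¹ * right * (up * right) else 1) *
    (up * right) ^ j) F

theorem triangleFrames_right (F : Frame) {i j : ℤ} (h : i - j = 1) :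
    triangleFrames F i j = right (triangleFrames F (i - 1) j) := by
  obtain rfl : i = j + 1 := by omega
  simp [triangleFrames]

theorem triangleFrames_up (F : Frame) {i j : ℤ} (h : i - j = 0 ∨ i - j = 1) :
    triangleFrames F i j = up (triangleFrames F i (j - 1)) := by
  have e : (up * right : Equiv.Perm Frame) ^ j = up * right * (up * right) ^ (j - 1) := by
    rw [← zpow_one_add, add_sub_cancel]
  rcases h with h | h
  · obtain rfl : i = j := by omega
    simp [triangleFrames, e, Equiv.Perm.mul_apply]
  · obtain rfl : i = j + 1 := by omega
    simp [triangleFrames, e, Equiv.Perm.mul_apply, show j + 1 - (j - 1) = 2 by ring]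

/-- The cylinder unfolded by `triangleFrames`. -/
def triangleCylinder (F : Frame) : Cylinder where
  D₁ := 1
  D₂ := 1
  v₁ := 3
  v₂ := 2
  m := 3
  fr := triangleFrames F
  D₁_nonneg := zero_le_one
  D₂_pos := one_pos
  D_le := by norm_num
  cross_v := by norm_num
  three_le := by norm_num
  two_le_m := by norm_num
  m_mul_le := by norm_num
  period i j := by
    have : (up * right : Equiv.Perm Frame) ^ (3 : ℤ) = 1 := ur_pow
    simp [triangleFrames, zpow_add, this]
  good_strip x y h0 h1 := by
    push_cast at h0 h1
    constructor <;> intro i hi <;> simp only at hi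
    · exact ⟨i - 1, by push_cast; linarith, by push_cast; linarith,
        triangleFrames_right F (by ring)⟩
    · exact ⟨i, by linarith, by linarith, triangleFrames_up F (by simp)⟩
  good_left k a b ha h h' := by
    constructor <;> intro i hi <;> push_cast at hi <;> exfalso
    · have : i < 3 + k := by exact_mod_cast (by linarith : (i : ℝ) < 3 + k)
      have : 3 + k - 1 < i := by exact_mod_cast (by linarith : (3 + k - 1 : ℝ) < i)
      omega
    · have : i < 2 + k := by exact_mod_cast (by linarith : (i : ℝ) < 2 + k)
      have : 2 + k - 1 < i := by exact_mod_cast (by linarith : (2 + k - 1 : ℝ) < i)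
      omega
  good_right k a b ha h h' := by
    constructor <;> intro i hi <;> push_cast at hi ⊢
    · exfalso
      have : i < 3 + k + 1 := by exact_mod_cast (by linarith : (i : ℝ) < 3 + k + 1)
      have : 3 + k < i := by exact_mod_cast (by linarith : (3 + k : ℝ) < i)
      omega
    · have : i < 2 + k + 1 := by exact_mod_cast (by linarith : (i : ℝ) < 2 + k + 1)
      have : 2 + k - 1 < i := by exact_mod_cast (by linarith : (2 + k - 1 : ℝ) < i)
      exact ⟨3 + k, by push_cast; linarith, by push_cast; linarith,
        triangleFrames_up F (by omega)⟩
  glue k a b i j ha h h' h1 h2 h3 h4 := by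
    push_cast at h1 h2 h3 h4
    have : -2 < i := by exact_mod_cast (by linarith : (-2 : ℝ) < i)
    have : i < 0 := by exact_mod_cast (by linarith : (i : ℝ) < 0)
    have : -2 < j := by exact_mod_cast (by linarith : (-2 : ℝ) < j)
    have : j < 0 := by exact_mod_cast (by linarith : (j : ℝ) < 0)
    obtain rfl : i = -1 := by omega
    obtain rfl : j = -1 := by omega
    have key : ∀ x : Frame, (up⁻¹ * right * (up * right)) x = (right x).turn := by decide
    simp only [triangleFrames]
    rw [if_neg (by omega), if_pos (by omega), if_pos (by omega)]
    exact key _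
  corner_up k := triangleFrames_up F (by left; ring)
  corner_right k := triangleFrames_right F (by ring)

/-- The unfolding of a cylinder whose sides consist of two geodesics of slope `1 / 2`, with this
slope in the plane. -/
def flatFrames (F : Frame) (i j : ℤ) : Frame :=
  ((if i - 2 * j = 1 then right else if i - 2 * j = 2 then right * right
    else if i - 2 * j = 3 then up⁻¹ * right * (up * right * right)
    else if i - 2 * j = 5 then
      up⁻¹ * (up⁻¹ * right * (up * right * right)) * (up * right * right) else 1) *
    (up * right * right) ^ j) F

theorem flatFrames_right (F : Frame) {i j : ℤ} (h : i - 2 * j = 1 ∨ i - 2 * j = 2) :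
    flatFrames F i j = right (flatFrames F (i - 1) j) := by
  rcases h with h | h
  · obtain rfl : i = 2 * j + 1 := by omega
    simp [flatFrames]
  · obtain rfl : i = 2 * j + 2 := by omega
    simp [flatFrames, show 2 * j + 2 - 1 - 2 * j = 1 by ring]

theorem flatFrames_up (F : Frame) {i j : ℤ}
    (h : i - 2 * j = 0 ∨ i - 2 * j = 1 ∨ i - 2 * j = 3) :
    flatFrames F i j = up (flatFrames F i (j - 1)) := by
  have e : (up * right * right : Equiv.Perm Frame) ^ j =
      up * right * right * (up * right * right) ^ (j - 1) := by
    rw [← zpow_one_add, add_sub_cancel]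
  have e' : i - 2 * (j - 1) = i - 2 * j + 2 := by ring
  rcases h with h | h | h <;> simp [flatFrames, e, e', h, Equiv.Perm.mul_apply]

/-- The cylinder unfolded by `flatFrames`. -/
def flatCylinder (F : Frame) : Cylinder where
  D₁ := 2
  D₂ := 1
  v₁ := 3
  v₂ := 1
  m := 2
  fr := flatFrames F
  D₁_nonneg := by norm_num
  D₂_pos := one_pos
  D_le := by norm_num
  cross_v := by norm_num
  three_le := by norm_num
  two_le_m := by norm_num
  m_mul_le := by norm_num
  period i j := by
    have : (up * right * right : Equiv.Perm Frame) ^ (2 : ℤ) = 1 := urr_pow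
    simp only [flatFrames, mul_one, show i + 2 * 2 - 2 * (j + 2) = i - 2 * j by ring, zpow_add,
      this]
  good_strip x y h0 h1 := by
    push_cast at h0 h1
    constructor <;> intro i hi <;> simp only at hi
    · have fl := Int.floor_le y
      have fl' := Int.lt_floor_add_one y
      have : 2 * ⌊y⌋ < i := by exact_mod_cast (by linarith : (2 * ⌊y⌋ : ℝ) < i)
      have : i < 2 * ⌊y⌋ + 3 := by exact_mod_cast (by linarith : (i : ℝ) < 2 * ⌊y⌋ + 3)
      refine ⟨⌊y⌋, lt_of_le_of_ne fl fun he => ?_, fl', flatFrames_right F (by omega)⟩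
      have : i < 2 * ⌊y⌋ + 1 := by exact_mod_cast (by linarith : (i : ℝ) < 2 * ⌊y⌋ + 1)
      omega
    · exact ⟨2 * i, by push_cast; linarith, by push_cast; linarith, flatFrames_up F (by simp)⟩
  good_left k a b ha h h' := by
    constructor <;> intro i hi <;> push_cast at hi ⊢
    · have : i < 3 + 2 * k := by exact_mod_cast (by linarith : (i : ℝ) < 3 + 2 * k)
      have : 3 + 2 * k - 2 < i := by exact_mod_cast (by linarith : (3 + 2 * k - 2 : ℝ) < i)
      exact ⟨k, by linarith, by linarith,
        flatFrames_right F (by omega)⟩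
    · exfalso
      have : i < 1 + k := by exact_mod_cast (by linarith : (i : ℝ) < 1 + k)
      have : k < i := by exact_mod_cast (by linarith : (k : ℝ) < i)
      omega
  good_right k a b ha h h' := by
    constructor <;> intro i hi <;> push_cast at hi ⊢
    · exfalso
      have : i < 3 + 2 * k + 1 := by exact_mod_cast (by linarith : (i : ℝ) < 3 + 2 * k + 1)
      have : 3 + 2 * k < i := by exact_mod_cast (by linarith : (3 + 2 * k : ℝ) < i)
      omega
    · have : i < 1 + k + 1 := by exact_mod_cast (by linarith : (i : ℝ) < 1 + k + 1)
      have : 1 + k - 2 < i := by exact_mod_cast (by linarith : (1 + k - 2 : ℝ) < i)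
      exact ⟨3 + 2 * k, by push_cast; linarith, by push_cast; linarith,
        flatFrames_up F (by omega)⟩
  glue k a b i j ha h h' h1 h2 h3 h4 := by
    push_cast at h1 h2 h3 h4
    have : -3 < i := by exact_mod_cast (by linarith : (-3 : ℝ) < i)
    have : i < 0 := by exact_mod_cast (by linarith : (i : ℝ) < 0)
    have : -2 < j := by exact_mod_cast (by linarith : (-2 : ℝ) < j)
    have : j < 0 := by exact_mod_cast (by linarith : (j : ℝ) < 0)
    obtain rfl : j = -1 := by omega
    -- The left outer triangle meets two lattice squares below the vertex, so the quarter turn needs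
    -- one identity for each.
    have key1 : ∀ x : Frame, (up⁻¹ * right * (up * right * right)) x =
      ((right * right) x).turn := by decide
    have key2 : ∀ x : Frame,
      (up⁻¹ * (up⁻¹ * right * (up * right * right)) * (up * right * right)) x =
      ((right * (up * right * right)) x).turn := by decide
    simp only [flatFrames]
    obtain rfl | rfl : i = -1 ∨ i = -2 := by omega
    · rw [if_neg (by omega), if_neg (by omega), if_pos (by omega), if_neg (by omega),
        if_pos (by omega)]
      exact key1 _
    · rw [if_neg (by omega), if_neg (by omega), if_neg (by omega), if_pos (by omega),
        if_pos (by omega), show 1 + k * 1 + -1 = 1 + (1 + k * 1 + -2) by ring, zpow_one_add]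
      exact key2 _
  corner_up k := flatFrames_up F (by left; ring)
  corner_right k := flatFrames_right F (by left; ring)

/-- The unfolding of a cylinder whose sides consist of two geodesics of slope `1 / 2`, with
slope `2` in the plane. -/
def steepFrames (F : Frame) (i j : ℤ) : Frame :=
  ((if 2 * i - j = -1 then up else if 2 * i - j = 1 then up⁻¹
    else if 2 * i - j = 2 then up⁻¹ * up⁻¹
    else if 2 * i - j = 4 then right * (up⁻¹ * up⁻¹) * (up * right * up)⁻¹ else 1) *
    (up * right * up) ^ i) F

theorem steepFrames_up (F : Frame) {i j : ℤ}
    (h : 2 * i - j = -1 ∨ 2 * i - j = 0 ∨ 2 * i - j = 1) :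
    steepFrames F i j = up (steepFrames F i (j - 1)) := by
  have e' : 2 * i - (j - 1) = 2 * i - j + 1 := by ring
  rcases h with h | h | h <;> simp [steepFrames, e', h, Equiv.Perm.mul_apply]

theorem steepFrames_right (F : Frame) {i j : ℤ} (h : 2 * i - j = 1 ∨ 2 * i - j = 4) :
    steepFrames F i j = right (steepFrames F (i - 1) j) := by
  have e : (up * right * up : Equiv.Perm Frame) ^ i =
      up * right * up * (up * right * up) ^ (i - 1) := by
    rw [← zpow_one_add, add_sub_cancel]
  have e' : 2 * (i - 1) - j = 2 * i - j - 2 := by ring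
  rcases h with h | h <;> simp [steepFrames, e, e', h, Equiv.Perm.mul_apply]

/-- The cylinder unfolded by `steepFrames`. -/
def steepCylinder (F : Frame) : Cylinder where
  D₁ := 1
  D₂ := 2
  v₁ := 2
  v₂ := 3
  m := 2
  fr := steepFrames F
  D₁_nonneg := zero_le_one
  D₂_pos := two_pos
  D_le := by norm_num
  cross_v := by norm_num
  three_le := by norm_num
  two_le_m := by norm_num
  m_mul_le := by norm_num
  period i j := by
    have : (up * right * up : Equiv.Perm Frame) ^ (2 : ℤ) = 1 := uru_pow
    simp only [steepFrames, mul_one, show 2 * (i + 2) - (j + 2 * 2) = 2 * i - j by ring, zpow_add,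
      this]
  good_strip x y h0 h1 := by
    push_cast at h0 h1
    constructor <;> intro i hi <;> simp only at hi
    · exact ⟨2 * i - 1, by push_cast; linarith, by push_cast; linarith,
        steepFrames_right F (by left; ring)⟩
    · have fl := Int.floor_le x
      have fl' := Int.lt_floor_add_one x
      have : 2 * ⌊x⌋ < i + 1 := by exact_mod_cast (by linarith : (2 * ⌊x⌋ : ℝ) < i + 1)
      have : i < 2 * ⌊x⌋ + 2 := by exact_mod_cast (by linarith : (i : ℝ) < 2 * ⌊x⌋ + 2)
      refine ⟨⌊x⌋, lt_of_le_of_ne fl fun he => ?_, fl', steepFrames_up F (by omega)⟩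
      have : i < 2 * ⌊x⌋ := by exact_mod_cast (by linarith : (i : ℝ) < 2 * ⌊x⌋)
      omega
  good_left k a b ha h h' := by
    constructor <;> intro i hi <;> push_cast at hi ⊢
    · exfalso
      have : i < 2 + k := by exact_mod_cast (by linarith : (i : ℝ) < 2 + k)
      have : 2 + k - 1 < i := by exact_mod_cast (by linarith : (2 + k - 1 : ℝ) < i)
      omega
    · have : i < 3 + 2 * k := by exact_mod_cast (by linarith : (i : ℝ) < 3 + 2 * k)
      have : 1 + 2 * k < i := by exact_mod_cast (by linarith : (1 + 2 * k : ℝ) < i)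
      exact ⟨1 + k, by push_cast; linarith, by push_cast; linarith,
        steepFrames_up F (by omega)⟩
  good_right k a b ha h h' := by
    constructor <;> intro i hi <;> push_cast at hi ⊢
    · have : i < 2 + k + 2 := by exact_mod_cast (by linarith : (i : ℝ) < 2 + k + 2)
      have : 2 + k < i := by exact_mod_cast (by linarith : (2 + k : ℝ) < i)
      obtain rfl : i = 3 + k := by omega
      push_cast at hi
      exact ⟨2 + 2 * k, by push_cast; linarith, by push_cast; linarith,
        steepFrames_right F (by omega)⟩
    · have : i < 3 + 2 * k + 1 := by exact_mod_cast (by linarith : (i : ℝ) < 3 + 2 * k + 1)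
      have : 2 + 2 * k < i := by exact_mod_cast (by linarith : (2 + 2 * k : ℝ) < i)
      obtain rfl : i = 3 + 2 * k := by omega
      push_cast at hi
      exact ⟨2 + k, by push_cast; linarith, by push_cast; linarith,
        steepFrames_up F (by omega)⟩
  glue k a b i j ha h h' h1 h2 h3 h4 := by
    push_cast at h1 h2 h3 h4
    have : -2 < i := by exact_mod_cast (by linarith : (-2 : ℝ) < i)
    have : i < 0 := by exact_mod_cast (by linarith : (i : ℝ) < 0)
    have : -3 < j := by exact_mod_cast (by linarith : (-3 : ℝ) < j)
    have : j < 0 := by exact_mod_cast (by linarith : (j : ℝ) < 0)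
    obtain rfl : i = -1 := by omega
    have key1 : ∀ x : Frame, (up⁻¹ * up⁻¹ * (up * right * up)) x = x.turn := by decide
    have key2 : ∀ x : Frame, (right * (up⁻¹ * up⁻¹) * (up * right * up)) x =
      (up⁻¹ x).turn := by decide
    simp only [steepFrames]
    obtain rfl | rfl : j = -1 ∨ j = -2 := by omega
    · rw [if_neg (by omega), if_neg (by omega), if_pos (by omega), if_neg (by omega),
        if_neg (by omega), if_neg (by omega), if_neg (by omega),
        show 2 + k * 1 - -1 - 1 = 1 + (2 + k * 1 + -1) by ring, zpow_one_add]
      exact key1 _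
    · rw [if_neg (by omega), if_neg (by omega), if_neg (by omega), if_pos (by omega),
        if_neg (by omega), if_pos (by omega),
        show 2 + k * 1 - -2 - 1 = 1 + (1 + (2 + k * 1 + -1)) by ring, zpow_one_add, zpow_one_add]
      have := key2 (((up * right * up) ^ (2 + k * 1 + -1)) F)
      simpa [mul_assoc] using this
  corner_up k := steepFrames_up F (by left; ring)
  corner_right k := steepFrames_right F (by left; ring)

end instances

/-! ### From starting slopes to cylinders. -/

section slopes

variable {L : ℝ} {γ : ℝ → Space}

/-- The origin is a lattice point and so not `Good`; the start is read off directly in the square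
`(0, 0)`, which the ray enters. -/
theorem follows_of_departs {fr : ℤ → ℤ → Frame} {F : Frame} {a : ℝ} {d : ℝ × ℝ} (hF : fr 0 0 = F)
    (ha : γ a = F.pt ![0, 0, 0]) (hd1 : 0 < d.1) (hd2 : 0 < d.2)
    (hd : d.1 * d.1 + d.2 * d.2 = 1) (h : Departs γ a (F.vec ![d.1, d.2, 0])) :
    Follows γ fr (0, 0) d := by
  have h0 : dev fr (0, 0) = F.pt ![0, 0, 0] := by simp [dev, hF]
  refine ⟨a, _, ha.trans h0.symm, h, ?_⟩
  have d1 : d.1 ≤ 1 := by nlinarith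
  have d2 : d.2 ≤ 1 := by nlinarith
  filter_upwards [Ico_mem_nhdsGE one_pos] with s hs
  have f : ∀ {x : ℝ}, 0 < x → x ≤ 1 → ⌊0 + s * x⌋ = 0 := fun {x} h0 h1 => by
    rw [Int.floor_eq_zero_iff, zero_add]
    exact ⟨mul_nonneg hs.1 h0.le, (mul_le_of_le_one_right hs.1 h1).trans_lt hs.2⟩
  rw [dev_of_mem (X := (0, 0) + s • d) (f hd1 d1) (f hd2 d2), h0, hF, Frame.pt_add_vec]
  simp

theorem slope_of_departs (hγ : IsSimpleClosedQuasigeodesic L γ) {F : Frame} {a σ c : ℝ}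
    (ha : γ a = F.pt ![0, 0, 0]) (hσ0 : 0 ≤ σ) (hσ1 : σ ≤ 1) (hc : 0 < c)
    (h : Departs γ a (F.vec ![c, c * σ, 0])) : σ ∈ ({0, 1 / 3, 1 / 2, 2 / 3, 1} : Set ℝ) := by
  by_contra hσ
  simp only [Set.mem_insert_iff, Set.mem_singleton_iff, not_or] at hσ
  obtain ⟨n0, n1, n2, n3, n4⟩ := hσ
  have hσ0 : 0 < σ := lt_of_le_of_ne hσ0 (Ne.symm n0)
  have hσ1 : σ < 1 := lt_of_le_of_ne hσ1 n4
  have hcσ : 0 < c * σ := mul_pos hc hσ0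
  have hn := Frame.sum_of_norm h.1
  simp only [Fin.sum_univ_three, Matrix.cons_val_zero, Matrix.cons_val_one, Matrix.cons_val,
    mul_zero, add_zero] at hn
  have run : ∀ C : Cylinder, C.fr 0 0 = F → 0 < C.lam (c, c * σ) →
      C.mu (C.v₁, C.v₂) * C.lam (c, c * σ) < C.mu (c, c * σ) → False := fun C hC hl hm =>
    C.not_follows hγ (d := (c, c * σ)) hn hc hcσ hl hm (follows_of_departs hC ha hc hcσ hn h)
  have run' : ∀ C : Cylinder, C.fr 0 0 = F.swap → 0 < C.lam (c * σ, c) →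
      C.mu (C.v₁, C.v₂) * C.lam (c * σ, c) < C.mu (c * σ, c) → False := fun C hC hl hm =>
    C.not_follows hγ (d := (c * σ, c)) (by simp only; linarith) hcσ hc hl hm
      (follows_of_departs hC (by rw [ha, Frame.pt_swap]) hcσ hc (by simp only; linarith)
        (by rwa [Frame.vec_swap]))
  -- The condition `lam > 0` bounds the slope by that of `D`, and the condition on `mu` bounds it by
  -- that of `v`. The four cylinders give the intervals `(0, 1/3)`, `(1/3, 1/2)`, `(1/2, 2/3)` and
  -- `(2/3, 1)`.
  rcases lt_or_gt_of_ne n1 with h1 | h1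
  · apply run' (squareCylinder F.swap) (by simp [squareCylinder, squareFrames]) <;>
      simp only [squareCylinder, Cylinder.lam, Cylinder.mu] <;> push_cast <;> nlinarith
  rcases lt_or_gt_of_ne n2 with h2 | h2
  · apply run (flatCylinder F) (by simp [flatCylinder, flatFrames]) <;>
      simp only [flatCylinder, Cylinder.lam, Cylinder.mu] <;> push_cast <;> nlinarith
  rcases lt_or_gt_of_ne n3 with h3 | h3
  · apply run' (steepCylinder F.swap) (by simp [steepCylinder, steepFrames]) <;>
      simp only [steepCylinder, Cylinder.lam, Cylinder.mu] <;> push_cast <;> nlinarith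
  · apply run (triangleCylinder F) (by simp [triangleCylinder, triangleFrames]) <;>
      simp only [triangleCylinder, Cylinder.lam, Cylinder.mu] <;> push_cast <;> nlinarith

theorem exists_frame {x : Space} (hx : IsVertex x) : ∃ F : Frame, x = F.pt ![0, 0, 0] := by
  classical
  refine ⟨(fun n => decide (x n = 1), 1), ?_⟩
  ext n
  have : ![(0 : ℝ), 0, 0] ((1 : Equiv.Perm (Fin 3)).symm n) = 0 := by fin_cases n <;> rfl
  simp only [Frame.pt, this, decide_eq_true_eq]
  rcases hx n with h | h <;> simp [h]

theorem exists_perm {m m' : Fin 3} (h : m ≠ m') : ∃ τ : Equiv.Perm (Fin 3), τ 0 = m ∧ τ 1 = m' := by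
  revert m m'; decide

theorem exists_axis {F : Frame} {x e : Space} (hx : x = F.pt ![0, 0, 0]) (he : ‖e‖ = 1)
    (hv : IsVertex (x + e)) : ∃ m : Fin 3, e = F.vec (Pi.single m 1) := by
  obtain ⟨v, rfl⟩ := F.exists_vec e
  have h1 := Frame.sum_of_norm he
  rw [hx, ← one_smul ℝ (F.vec v), Frame.pt_add_smul_vec, Frame.isVertex_pt] at hv
  have hv : ∀ n, v n = 0 ∨ v n = 1 := fun n => by
    have := hv n
    have h0 : ![(0 : ℝ), 0, 0] n = 0 := by fin_cases n <;> rfl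
    simpa only [h0, zero_add, one_mul] using this
  simp only [Fin.sum_univ_three] at h1
  suffices ∃ m, v = Pi.single m 1 by
    obtain ⟨m, hm⟩ := this
    exact ⟨m, by rw [hm]⟩
  rcases hv 0 with h0 | h0 <;> rcases hv 1 with h2 | h2 <;> rcases hv 2 with h3 | h3 <;>
    rw [h0, h2, h3] at h1 <;> norm_num at h1
  · exact ⟨2, by ext n; fin_cases n <;> simp [h0, h2, h3]⟩
  · exact ⟨1, by ext n; fin_cases n <;> simp [h0, h2, h3]⟩
  · exact ⟨0, by ext n; fin_cases n <;> simp [h0, h2, h3]⟩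

theorem HasStartingSlope.mem (hγ : IsSimpleClosedQuasigeodesic L γ) {a σ : ℝ}
    (ha : IsVertex (γ a)) (h : HasStartingSlope γ a σ) :
    σ ∈ ({0, 1 / 3, 1 / 2, 2 / 3, 1} : Set ℝ) := by
  obtain ⟨h0, h1, i, b, e, e', w, -, hne, he, hv, -, he', hv', -, hw, c, hc, rfl⟩ := h
  obtain ⟨F, hF⟩ := exists_frame ha
  obtain ⟨m, rfl⟩ := exists_axis hF he hv
  obtain ⟨m', rfl⟩ := exists_axis hF he' hv'
  obtain ⟨τ, rfl, rfl⟩ := exists_perm (fun h : m = m' => hne (by rw [h]))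
  refine slope_of_departs hγ (a := a) (F := (F.1, F.2 * τ)) (c := c) ?_ h0 h1 hc ?_
  · rw [hF, Frame.pt_comp]
    congr 1
    ext n
    obtain ⟨k, rfl⟩ := τ.surjective n
    have z : ∀ n, ![(0 : ℝ), 0, 0] n = 0 := by intro n; fin_cases n <;> rfl
    rw [Function.comp_apply, z, z]
  · convert hw using 1
    rw [Frame.vec_comp]
    ext n
    obtain ⟨l, rfl⟩ := F.2.surjective n
    obtain ⟨k, rfl⟩ := τ.surjective l
    simp only [Frame.vec, PiLp.smul_apply, PiLp.add_apply, Equiv.symm_apply_apply, smul_eq_mul,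
      Function.comp_apply]
    fin_cases k <;> cases F.1 _ <;> simp

theorem hasStartingSlope_of_departs {F : Frame} {a p q : ℝ} (ha : γ a = F.pt ![0, 0, 0])
    (hp : 0 < p) (hq : 0 ≤ q) (hqp : q ≤ p) (h : Departs γ a (F.vec ![p, q, 0])) :
    HasStartingSlope γ a (q / p) := by
  have pe : F.pt ![0, 0, 0] + F.vec ![1, 0, 0] = F.pt ![1, 0, 0] := by
    simpa using F.pt_add_vec 0 0 1 0 1
  have pe' : F.pt ![0, 0, 0] + F.vec ![0, 1, 0] = F.pt ![0, 1, 0] := by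
    simpa using F.pt_add_vec 0 0 0 1 1
  have hf : ∀ x y : ℝ, x ∈ Set.Icc (0 : ℝ) 1 → y ∈ Set.Icc (0 : ℝ) 1 →
      F.pt ![x, y, 0] ∈ face (F.2 2) (F.1 (F.2 2)) := fun x y hx hy => by
    rw [Frame.pt_mem_face]
    refine ⟨fun n => ?_, rfl⟩
    fin_cases n
    · exact hx
    · exact hy
    · simp
  refine ⟨div_nonneg hq hp.le, (div_le_one hp).2 hqp, F.2 2, F.1 (F.2 2), F.vec ![1, 0, 0],
    F.vec ![0, 1, 0], F.vec ![p, q, 0], ?_, ?_, F.norm_vec_pair (by norm_num), ?_, ?_,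
    F.norm_vec_pair (by norm_num), ?_, ?_, h, p, hp, ?_⟩
  · rw [ha]; exact hf 0 0 (by simp) (by simp)
  · intro he
    have := congrFun (F.vec_injective he) 0
    simp at this
  · rw [ha, pe, Frame.isVertex_pt]; intro n; fin_cases n <;> simp
  · rw [ha, pe]; exact hf 1 0 (by simp) (by simp)
  · rw [ha, pe', Frame.isVertex_pt]; intro n; fin_cases n <;> simp
  · rw [ha, pe']; exact hf 0 1 (by simp) (by simp)
  · obtain ⟨q, rfl⟩ : ∃ r, q = p * r := ⟨q / p, by field_simp⟩
    rw [mul_div_cancel_left₀ _ hp.ne']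
    ext n
    obtain ⟨k, rfl⟩ := F.2.surjective n
    simp only [Frame.vec, PiLp.smul_apply, PiLp.add_apply, Equiv.symm_apply_apply, smul_eq_mul]
    fin_cases k <;> cases F.1 _ <;> simp

theorem exists_hasStartingSlope (hγ : IsSimpleClosedQuasigeodesic L γ) {a : ℝ}
    (ha : IsVertex (γ a)) : ∃ σ, HasStartingSlope γ a σ := by
  obtain ⟨F, hF⟩ := exists_frame ha
  obtain ⟨u, w, -, hw, -⟩ := hγ.quasigeodesic a
  obtain ⟨w', rfl, hw1, ⟨m, -, hm⟩, hw0⟩ := hw.exists_dir hγ.mem_surface F hF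
  have z : ∀ n, ![(0 : ℝ), 0, 0] n = 0 := by intro n; fin_cases n <;> rfl
  have hw0 : ∀ n, 0 ≤ w' n := fun n => hw0 n (z n)
  -- Reorder the axes so that the face containing the departing direction becomes the face `z = 0`
  -- of the frame.
  set τ : Equiv.Perm (Fin 3) := Equiv.swap 2 m with hτ
  set G : Frame := (F.1, F.2 * τ) with hG
  have hG0 : γ a = G.pt ![0, 0, 0] := by
    rw [hF, Frame.pt_comp]
    congr 1
    ext n
    rw [Function.comp_apply, z, z]
  have hGw : F.vec w' = G.vec ![w' (τ 0), w' (τ 1), 0] := by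
    rw [Frame.vec_comp]
    congr 1
    ext n
    obtain ⟨k, rfl⟩ := τ.surjective n
    rw [Function.comp_apply, Equiv.symm_apply_apply]
    fin_cases k
    · rfl
    · rfl
    · simp [hτ, hm]
  rw [hGw] at hw
  have hn := Frame.sum_of_norm hw.1
  simp only [Fin.sum_univ_three, Matrix.cons_val_zero, Matrix.cons_val_one, Matrix.cons_val,
    mul_zero, add_zero] at hn
  have h0 := hw0 (τ 0)
  have h1 := hw0 (τ 1)
  rcases le_total (w' (τ 1)) (w' (τ 0)) with h | h
  · refine ⟨_, hasStartingSlope_of_departs hG0 ?_ h1 h hw⟩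
    by_contra hle
    nlinarith
  · rw [← Frame.pt_swap] at hG0
    rw [← Frame.vec_swap] at hw
    refine ⟨_, hasStartingSlope_of_departs hG0 ?_ h0 h hw⟩
    by_contra hle
    nlinarith

end slopes
end CubeQuasigeodesic
end

theorem mainTheorem2 (L : ℝ) (γ : ℝ → CubeQuasigeodesic.Space)
    (hγ : CubeQuasigeodesic.IsSimpleClosedQuasigeodesic L γ) (a b : ℝ)
    (hseg : CubeQuasigeodesic.IsGeodesicSegment γ a b) :
    (∃ σ : ℝ, CubeQuasigeodesic.HasStartingSlope γ a σ) ∧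
      ∀ σ : ℝ, CubeQuasigeodesic.HasStartingSlope γ a σ →
        σ ∈ ({0, 1 / 3, 1 / 2, 2 / 3, 1} : Set ℝ) :=
  ⟨CubeQuasigeodesic.exists_hasStartingSlope hγ hseg.start_vertex,
    fun _ h => h.mem hγ hseg.start_vertex⟩
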